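/- For $\alpha,\beta,F\in\mathbb{C}$ let $\mathcal{L}=\mathcal{L}_{\alpha,\beta,F}$ be the extended Heisenberg-Virasoro algebra, that is, the complex Lie algebra with basis $L_m,J_m,G_m$ ($m\in\mathbb{Z}$), $C_1,C_2,C_3$, where $C_1,C_2,C_3$ are central and, for $m,n\in\mathbb{Z}$, $$[L_m,L_n]=(m-n)L_{m+n}+\tfrac{m^3-m}{12}\delta_{m+n,0}C_1,\qquad [L_m,J_n]=-nJ_{m+n}-(m^2+m)\delta_{m+n,0}C_2,$$ $$[J_m,J_n]=m\delta_{m+n,0}C_3,\quad [L_m,G_n]=-(\alpha+n+m\beta)G_{m+n},\quad [J_m,G_n]=FG_{m+n},\quad [G_m,G_n]=0.$$ For an integer $d\ge 0$ let $\mathcal{L}_d$ be the subalgebra spanned by $L_i,J_i,G_{-d+i}$ ($i\ge 0$) and $C_1,C_2,C_3$. For an $\mathcal{L}_d$-module $V$ let $\mathrm{Ind}_{\mathcal{L}_d}^{\mathcal{L}}(V)=U(\mathcal{L})\otimes_{U(\mathcal{L}_d)}V$. An $\mathcal{L}$-module $S$ is called restricted if for every $v\in S$ one has $L_mv=J_mv=G_mv=0$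 for all sufficiently large $m$. For integers $r,s,t$ put $$N_{r,s,t}=\{v\in S\mid G_{r+i}v=J_{s+i}v=L_{t+i}v=0\text{ for all integers } i\ge 1\}.$$ Theorem. Suppose $F\neq 0$. Let $S$ be a simple restricted $\mathcal{L}$-module, and assume that there are integers $a,b\ge 0$ such that $G_a$ and $L_b$ act injectively on $S$. Then there exist integers $k,d,l\ge 0$ with $k+d>0$ such that (i) $N_{k,k+d,l}\neq 0$; (ii) $G_k$ and $L_l$ act injectively on $N_{k,k+d,l}$. Furthermore, let $k,d,l\ge 0$ be any integers with $k+d>0$ that satisfy (i) and (ii), and suppose that $l>k+d$. Then $V=N_{k,k+d,l}$ is stable under $\mathcal{L}_d$ and is a simple $\mathcal{L}_d$-module; $l>k+d>0$, $G_k$ and $L_l$ act injectively on $V$, and $G_{k+i}V=J_{k+d+i}V=L_{l+i}V=0$ for all integers $i\ge 1$; and $S\cong\mathrm{Ind}_{\mathcal{L}_d}^{\mathcal{L}}(V)$ as $\mathcal{L}$-modules. -/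

import Mathlib

open scoped TensorProduct

noncomputable section

attribute [local instance 100] LieRing.ofAssociativeRing

/-! ## Induced modules of Lie algebras -/

section Induced

variable (R : Type*) {L : Type*} [CommRing R] [LieRing L] [LieAlgebra R L]
variable (H : LieSubalgebra R L)
variable (V : Type*) [AddCommGroup V] [Module R V] [LieRingModule H V] [LieModule R H V]

/-- The ring homomorphism `U(H) → U(L)` induced by the inclusion `H ⊆ L`. -/
def envelopingIncl : UniversalEnvelopingAlgebra R H →ₐ[R] UniversalEnvelopingAlgebra R L :=
  UniversalEnvelopingAlgebra.lift R ((UniversalEnvelopingAlgebra.ι R).comp H.incl)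

/-- The action of `U(H)` on an `H`-module `V`. -/
def envelopingAction : UniversalEnvelopingAlgebra R H →ₐ[R] Module.End R V :=
  UniversalEnvelopingAlgebra.lift R (LieModule.toEnd R H V)

/-- The relations `(u h) ⊗ v - u ⊗ (h v)`, for `u ∈ U(L)`, `h ∈ U(H)`, `v ∈ V`, by which one passes
from `U(L) ⊗_R V` to `U(L) ⊗_{U(H)} V`. They span a left `U(L)`-submodule. -/
def inducedRelations :
    Submodule (UniversalEnvelopingAlgebra R L) (UniversalEnvelopingAlgebra R L ⊗[R] V) :=
  Submodule.span (UniversalEnvelopingAlgebra R L)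
    {z | ∃ (u : UniversalEnvelopingAlgebra R L) (h : UniversalEnvelopingAlgebra R H) (v : V),
      z = (u * envelopingIncl R H h) ⊗ₜ[R] v - u ⊗ₜ[R] (envelopingAction R H V h v)}

/-- The induced module `Ind_H^L(V) = U(L) ⊗_{U(H)} V`, a left `U(L)`-module. -/
abbrev InducedModule : Type _ :=
  (UniversalEnvelopingAlgebra R L ⊗[R] V) ⧸ inducedRelations R H V

/-- `L` acts on `U(L) ⊗_{U(H)} V` through `ι : L → U(L)`. -/
instance InducedModule.instLieRingModule : LieRingModule L (InducedModule R H V) where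
  bracket x m := UniversalEnvelopingAlgebra.ι R x • m
  add_lie x y m := by
    change UniversalEnvelopingAlgebra.ι R (x + y) • m = _ • m + _ • m
    rw [map_add, add_smul]
  lie_add x m n := smul_add (UniversalEnvelopingAlgebra.ι R x) m n
  leibniz_lie x y m := by
    change UniversalEnvelopingAlgebra.ι R x • UniversalEnvelopingAlgebra.ι R y • m =
      UniversalEnvelopingAlgebra.ι R ⁅x, y⁆ • m +
      UniversalEnvelopingAlgebra.ι R y • UniversalEnvelopingAlgebra.ι R x • m
    rw [LieHom.map_lie, LieRing.of_associative_ring_bracket, sub_smul, mul_smul, mul_smul,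
      sub_add_cancel]

instance InducedModule.instLieModule : LieModule R L (InducedModule R H V) where
  smul_lie t x m := by
    change UniversalEnvelopingAlgebra.ι R (t • x) • m = t • UniversalEnvelopingAlgebra.ι R x • m
    rw [map_smul, smul_assoc]
  lie_smul t x m := by
    change UniversalEnvelopingAlgebra.ι R x • t • m = t • UniversalEnvelopingAlgebra.ι R x • m
    rw [smul_algebra_smul_comm]

end Induced

/-! ## The extended Heisenberg-Virasoro algebra -/

/-- Labels of the basis elements `L_m`, `J_m`, `G_m` (`m ∈ ℤ`), `C_1`, `C_2`, `C_3`. -/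
inductive EHVIndex : Type
  | L (m : ℤ)
  | J (m : ℤ)
  | G (m : ℤ)
  | C1
  | C2
  | C3

/-- The complex vector space with basis `L_m`, `J_m`, `G_m` (`m ∈ ℤ`), `C_1`, `C_2`, `C_3`. The
parameters only enter its Lie bracket, defined below. -/
def ExtHV (_α _β _F : ℂ) : Type := EHVIndex →₀ ℂ

namespace ExtHV

variable (α β F : ℂ)

instance : AddCommGroup (ExtHV α β F) := inferInstanceAs (AddCommGroup (EHVIndex →₀ ℂ))
instance : Module ℂ (ExtHV α β F) := inferInstanceAs (Module ℂ (EHVIndex →₀ ℂ))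

/-- The basis of the extended Heisenberg-Virasoro algebra. -/
def basis : Module.Basis EHVIndex ℂ (ExtHV α β F) := Module.Basis.ofRepr (LinearEquiv.refl ℂ _)

/-- The basis element `L_m`. -/
def L (m : ℤ) : ExtHV α β F := basis α β F (.L m)
/-- The basis element `J_m`. -/
def J (m : ℤ) : ExtHV α β F := basis α β F (.J m)
/-- The basis element `G_m`. -/
def G (m : ℤ) : ExtHV α β F := basis α β F (.G m)
/-- The central basis element `C_1`. -/
def C1 : ExtHV α β F := basis α β F .C1
/-- The central basis element `C_2`. -/
def C2 : ExtHV α β F := basis α β F .C2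
/-- The central basis element `C_3`. -/
def C3 : ExtHV α β F := basis α β F .C3

/-- The bracket of two basis elements. -/
def basisBracket : EHVIndex → EHVIndex → ExtHV α β F
  | .L m, .L n => ((m : ℂ) - n) • L α β F (m + n)
      + (if m + n = 0 then (((m : ℂ) ^ 3 - m) / 12) • C1 α β F else 0)
  | .L m, .J n => (-(n : ℂ)) • J α β F (m + n)
      - (if m + n = 0 then ((m : ℂ) ^ 2 + m) • C2 α β F else 0)
  | .J n, .L m => -((-(n : ℂ)) • J α β F (m + n)
      - (if m + n = 0 then ((m : ℂ) ^ 2 + m) • C2 α β F else 0))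
  | .J m, .J n => if m + n = 0 then (m : ℂ) • C3 α β F else 0
  | .L m, .G n => (-(α + n + m * β)) • G α β F (m + n)
  | .G n, .L m => -((-(α + n + m * β)) • G α β F (m + n))
  | .J m, .G n => F • G α β F (m + n)
  | .G n, .J m => -(F • G α β F (m + n))
  | .G _, .G _ => 0
  | .C1, _ => 0
  | .C2, _ => 0
  | .C3, _ => 0
  | _, .C1 => 0
  | _, .C2 => 0
  | _, .C3 => 0

/-- The bilinear extension of `basisBracket`. -/
def bracketBilin : ExtHV α β F →ₗ[ℂ] ExtHV α β F →ₗ[ℂ] ExtHV α β F :=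
  (basis α β F).constr ℂ fun x => (basis α β F).constr ℂ fun y => basisBracket α β F x y

theorem bracketBilin_basis (x y : EHVIndex) :
    bracketBilin α β F (basis α β F x) (basis α β F y) = basisBracket α β F x y := by
  simp [bracketBilin, Module.Basis.constr_basis]

theorem basisBracket_skew (x y : EHVIndex) :
    basisBracket α β F x y = - basisBracket α β F y x := by
  rcases x with m | m | m | _ | _ | _ <;> rcases y with n | n | n | _ | _ | _ <;>
    simp only [basisBracket, neg_zero, neg_neg]
  · rw [add_comm n m]
    split_ifs with h
    · obtain rfl : n = -m := by omega
      push_cast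
      module
    · module
  · rw [add_comm n m]
    split_ifs with h
    · obtain rfl : n = -m := by omega
      push_cast
      module
    · simp

theorem bracketBilin_skew (x y : ExtHV α β F) :
    bracketBilin α β F x y = - bracketBilin α β F y x := by
  have h : bracketBilin α β F = - (bracketBilin α β F).flip := by
    refine (basis α β F).ext fun i => (basis α β F).ext fun j => ?_
    simp only [LinearMap.neg_apply, LinearMap.flip_apply, bracketBilin_basis]
    exact basisBracket_skew α β F i j
  exact congrArg (fun f => f x y) h

theorem ite_apply_zero (p : Prop) [Decidable p] (f g : ExtHV α β F →ₗ[ℂ] ExtHV α β F)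
    (x : ExtHV α β F) : (if p then f else g) x = if p then f x else g x := by
  split_ifs <;> rfl

set_option linter.unusedSimpArgs false in
set_option maxHeartbeats 1600000 in
theorem bracketBilin_jacobi_basis (x y z : EHVIndex) :
    bracketBilin α β F (basis α β F x) (basisBracket α β F y z) =
      bracketBilin α β F (basisBracket α β F x y) (basis α β F z) +
      bracketBilin α β F (basis α β F y) (basisBracket α β F x z) := by
  rcases x with m | m | m | _ | _ | _ <;> rcases y with n | n | n | _ | _ | _ <;>
    rcases z with p | p | p | _ | _ | _ <;>
    simp only [basisBracket, L, J, G, C1, C2, C3, map_add, map_sub, map_neg, map_smul, map_zero,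
      LinearMap.add_apply, LinearMap.sub_apply, LinearMap.neg_apply, LinearMap.smul_apply,
      LinearMap.zero_apply, apply_ite (bracketBilin α β F), apply_ite (bracketBilin α β F _),
      ite_apply_zero, bracketBilin_basis, smul_zero, neg_zero, add_zero, zero_add, sub_zero,
      ite_self, Int.add_left_comm, Int.add_comm] <;>
    first
    | done
    | (push_cast; module)
    | (by_cases h : m + (n + p) = 0
       · obtain rfl : p = -m - n := by omega
         simp only [h, if_true]
         push_cast
         module
       · simp only [h, if_false]
         push_cast
         module)

theorem bracketBilin_jacobi (x y z : ExtHV α β F) :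
    bracketBilin α β F x (bracketBilin α β F y z) =
      bracketBilin α β F (bracketBilin α β F x y) z +
      bracketBilin α β F y (bracketBilin α β F x z) := by
  let B := bracketBilin α β F
  let b := basis α β F
  have h : ∀ i j (z : ExtHV α β F), B (b i) (B (b j) z) = B (B (b i) (b j)) z + B (b j) (B (b i) z) := by
    intro i j
    have : (B (b i)).comp (B (b j)) = B (B (b i) (b j)) + (B (b j)).comp (B (b i)) := by
      refine b.ext fun k => ?_
      simp only [LinearMap.comp_apply, LinearMap.add_apply, B, b, bracketBilin_basis]
      exact bracketBilin_jacobi_basis α β F i j k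
    intro z
    exact congrArg (fun f => f z) this
  have h2 : ∀ i (y z : ExtHV α β F), B (b i) (B y z) = B (B (b i) y) z + B y (B (b i) z) := by
    intro i y z
    have : (B (b i)).comp (B.flip z) = (B.flip z).comp (B (b i)) + B.flip (B (b i) z) := by
      refine b.ext fun j => ?_
      simpa using h i j z
    exact congrArg (fun f => f y) this
  have : (B.flip (B y z)) = (B.flip z).comp (B.flip y) + (B y).comp (B.flip z) := by
    refine b.ext fun i => ?_
    simpa using h2 i y z
  exact congrArg (fun f => f x) this

instance : LieRing (ExtHV α β F) where
  bracket x y := bracketBilin α β F x y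
  add_lie x y z := by
    change bracketBilin α β F (x + y) z = bracketBilin α β F x z + bracketBilin α β F y z
    simp
  lie_add x y z := map_add (bracketBilin α β F x) y z
  lie_self x := by
    have h : bracketBilin α β F x x = - bracketBilin α β F x x := bracketBilin_skew α β F x x
    have h2 : (2 : ℂ) • bracketBilin α β F x x = 0 := by
      rw [two_smul]
      nth_rewrite 1 [h]
      exact neg_add_cancel _
    exact (smul_eq_zero.mp h2).resolve_left two_ne_zero
  leibniz_lie x y z := bracketBilin_jacobi α β F x y z

instance : LieAlgebra ℂ (ExtHV α β F) where
  lie_smul t x y := map_smul (bracketBilin α β F x) t y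

theorem lie_basis (x y : EHVIndex) :
    ⁅basis α β F x, basis α β F y⁆ = basisBracket α β F x y :=
  bracketBilin_basis α β F x y

/-! ### The subalgebras `𝓛_d` -/

/-- The labels of the basis elements `L_i`, `J_i`, `G_{-d+i}` (`i ≥ 0`), `C_1`, `C_2`, `C_3`. -/
def IsSubIndex (d : ℕ) : EHVIndex → Prop
  | .L m => 0 ≤ m
  | .J m => 0 ≤ m
  | .G m => -(d : ℤ) ≤ m
  | .C1 => True
  | .C2 => True
  | .C3 => True

/-- The set of these labels. -/
def subIndex (d : ℕ) : Set EHVIndex := {x | IsSubIndex d x}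

theorem basis_mem_span (d : ℕ) {x : EHVIndex} (hx : x ∈ subIndex d) :
    basis α β F x ∈ Submodule.span ℂ (basis α β F '' subIndex d) :=
  Submodule.subset_span ⟨x, hx, rfl⟩

theorem basisBracket_mem_span (d : ℕ) (x y : EHVIndex) (hx : x ∈ subIndex d)
    (hy : y ∈ subIndex d) :
    basisBracket α β F x y ∈ Submodule.span ℂ (basis α β F '' subIndex d) := by
  have hL : ∀ m : ℤ, 0 ≤ m → L α β F m ∈ Submodule.span ℂ (basis α β F '' subIndex d) :=
    fun m hm => basis_mem_span α β F d (x := .L m) hm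
  have hJ : ∀ m : ℤ, 0 ≤ m → J α β F m ∈ Submodule.span ℂ (basis α β F '' subIndex d) :=
    fun m hm => basis_mem_span α β F d (x := .J m) hm
  have hG : ∀ m : ℤ, -(d : ℤ) ≤ m → G α β F m ∈ Submodule.span ℂ (basis α β F '' subIndex d) :=
    fun m hm => basis_mem_span α β F d (x := .G m) hm
  have h1 : C1 α β F ∈ Submodule.span ℂ (basis α β F '' subIndex d) :=
    basis_mem_span α β F d (x := .C1) trivial
  have h2 : C2 α β F ∈ Submodule.span ℂ (basis α β F '' subIndex d) :=
    basis_mem_span α β F d (x := .C2) trivial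
  have h3 : C3 α β F ∈ Submodule.span ℂ (basis α β F '' subIndex d) :=
    basis_mem_span α β F d (x := .C3) trivial
  have hite : ∀ (p : Prop) [Decidable p] (c : ℂ) (z : ExtHV α β F),
      z ∈ Submodule.span ℂ (basis α β F '' subIndex d) →
      (if p then c • z else 0) ∈ Submodule.span ℂ (basis α β F '' subIndex d) := by
    intro p _ c z hz
    split_ifs
    · exact Submodule.smul_mem _ _ hz
    · exact Submodule.zero_mem _
  rcases x with m | m | m | _ | _ | _ <;> rcases y with n | n | n | _ | _ | _ <;>
    simp only [basisBracket, subIndex, IsSubIndex, Set.mem_ofPred_eq, zero_mem, neg_mem_iff] at hx hy ⊢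
  · exact add_mem (Submodule.smul_mem _ _ (hL _ (by omega))) (hite _ _ _ h1)
  · exact sub_mem (Submodule.smul_mem _ _ (hJ _ (by omega))) (hite _ _ _ h2)
  · exact Submodule.smul_mem _ _ (hG _ (by omega))
  · exact sub_mem (Submodule.smul_mem _ _ (hJ _ (by omega))) (hite _ _ _ h2)
  · exact hite _ _ _ h3
  · exact Submodule.smul_mem _ _ (hG _ (by omega))
  · exact Submodule.smul_mem _ _ (hG _ (by omega))
  · exact Submodule.smul_mem _ _ (hG _ (by omega))

/-- The subalgebra `𝓛_d`, spanned by `L_i`, `J_i`, `G_{-d+i}` (`i ≥ 0`), `C_1`, `C_2`, `C_3`. -/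
def sub (d : ℕ) : LieSubalgebra ℂ (ExtHV α β F) where
  __ := Submodule.span ℂ (basis α β F '' subIndex d)
  lie_mem' {x y} hx hy := by
    change x ∈ Submodule.span ℂ (basis α β F '' subIndex d) at hx
    change y ∈ Submodule.span ℂ (basis α β F '' subIndex d) at hy
    change bracketBilin α β F x y ∈ Submodule.span ℂ (basis α β F '' subIndex d)
    induction hx, hy using Submodule.span_induction₂ with
    | mem_mem x y hx hy =>
      obtain ⟨i, hi, rfl⟩ := hx
      obtain ⟨j, hj, rfl⟩ := hy
      rw [bracketBilin_basis]
      exact basisBracket_mem_span α β F d i j hi hj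
    | zero_left y hy => simp
    | zero_right x hx => simp
    | add_left x y z _ _ _ h1 h2 => simpa using add_mem h1 h2
    | add_right x y z _ _ _ h1 h2 => simpa using add_mem h1 h2
    | smul_left r x y _ _ h => simpa using Submodule.smul_mem _ r h
    | smul_right r x y _ _ h => simpa using Submodule.smul_mem _ r h

/-- `L_m` as an element of `𝓛_d`, for `m ≥ 0`. -/
def subL (d m : ℕ) : sub α β F d :=
  ⟨L α β F m, basis_mem_span α β F d (x := .L m) (Int.natCast_nonneg m)⟩
/-- `J_m` as an element of `𝓛_d`, for `m ≥ 0`. -/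
def subJ (d m : ℕ) : sub α β F d :=
  ⟨J α β F m, basis_mem_span α β F d (x := .J m) (Int.natCast_nonneg m)⟩
/-- `G_m` as an element of `𝓛_d`, for `m ≥ 0`. -/
def subG (d m : ℕ) : sub α β F d :=
  ⟨G α β F m, basis_mem_span α β F d (x := .G m)
    ((neg_nonpos.mpr (Int.natCast_nonneg d)).trans (Int.natCast_nonneg m))⟩

/-! ### Modules -/

section Modules

variable (S : Type*) [AddCommGroup S] [Module ℂ S] [LieRingModule (ExtHV α β F) S]
  [LieModule ℂ (ExtHV α β F) S]

/-- `S` is restricted: each `v ∈ S` is killed by `L_m`, `J_m`, `G_m` for `m` sufficiently large. -/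
def IsRestricted : Prop :=
  ∀ v : S, ∃ M : ℤ, ∀ m : ℤ, M ≤ m →
    ⁅L α β F m, v⁆ = 0 ∧ ⁅J α β F m, v⁆ = 0 ∧ ⁅G α β F m, v⁆ = 0

/-- The subspace `N_{r,s,t}` of the vectors killed by `G_{r+i}`, `J_{s+i}`, `L_{t+i}`, `i ≥ 1`. -/
def annihilated (r s t : ℤ) : Submodule ℂ S where
  carrier := {v | ∀ i : ℕ, 1 ≤ i →
    ⁅G α β F (r + i), v⁆ = 0 ∧ ⁅J α β F (s + i), v⁆ = 0 ∧ ⁅L α β F (t + i), v⁆ = 0}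
  zero_mem' := fun i _ => by simp
  add_mem' := fun {v w} hv hw i hi => by
    obtain ⟨h1, h2, h3⟩ := hv i hi
    obtain ⟨g1, g2, g3⟩ := hw i hi
    simp [h1, h2, h3, g1, g2, g3]
  smul_mem' := fun c v hv i hi => by
    obtain ⟨h1, h2, h3⟩ := hv i hi
    simp [h1, h2, h3]

/-- Conditions, for given `k` and `l`, on an `𝓛_d`-module `V`: `l > k + d > 0`, `G_k` and `L_l` act
injectively on `V`, and `G_{k+i} V = J_{k+d+i} V = L_{l+i} V = 0` for all `i ≥ 1`. -/
structure InductionConditions (d k l : ℕ) (V : Type*) [AddCommGroup V] [Module ℂ V]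
    [LieRingModule (sub α β F d) V] [LieModule ℂ (sub α β F d) V] : Prop where
  lt : k + d < l
  pos : 0 < k + d
  injective_G : Function.Injective fun v : V => ⁅subG α β F d k, v⁆
  injective_L : Function.Injective fun v : V => ⁅subL α β F d l, v⁆
  G_eq_zero : ∀ i : ℕ, 1 ≤ i → ∀ v : V, ⁅subG α β F d (k + i), v⁆ = 0
  J_eq_zero : ∀ i : ℕ, 1 ≤ i → ∀ v : V, ⁅subJ α β F d (k + d + i), v⁆ = 0
  L_eq_zero : ∀ i : ℕ, 1 ≤ i → ∀ v : V, ⁅subL α β F d (l + i), v⁆ = 0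

end Modules

end ExtHV

end

/-! Existence is a minimality argument. Restrictedness makes some `annihilated` space nonzero; take
the least `k` for which one is nonzero, then the least `l` for that `k`, and `d` large. A nonzero
vector killed by `G_k` or `L_l` would lower `k` or `l`, or contradict injectivity of `G_a` or `L_b`.

For the rest, put `V = N_{k,k+d,l}` and let `X` run over the basis elements outside `𝓛_d`.
Everything follows from one statement: sorted words in `X` applied to `V` are independent in `S`,
that is, `sortedWordMap` is injective. In any module generated by an `𝓛_d`-stable subspace, sorted
words applied to that subspace also span. Applied to the induced module, spanning shows that the
canonical map to `S` is injective; it is onto because `S` is simple. Applied to a nonzero submodule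
`W` of `V`, spanning writes each `v ∈ V` as a combination of words on `W`, and comparing the
coefficients of the empty word gives `v ∈ W`.

Independence is proved by lowering weights. Give each outer basis element its negated degree as
weight. Each outer `a` has a dual element `x` that kills `V`, such that `[x, X a]` acts injectively
on `V`: a nonzero multiple of `L_l` or `G_k`. For `a` of least weight among the letters present, and
of least rank within that weight, `x` acts on top-weight words like the derivative with respect to
`a`, up to terms of smaller weight (`lie_lieWord_sub_leading_mem`). Differentiating a relation gives
one of smaller weight, and induction finishes (`eq_zero_of_sortedWordMap_mem`). Two filtrations do
the bookkeeping: `E` by degree, and `D` by `order`, which measures by how much an element exceeds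
`G_k`, `J_{k+d}` or `L_l`. The duals are found in `exists_dual`; this is where `F ≠ 0` and `l > k +
d` enter. -/

noncomputable section

attribute [local instance 100] LieRing.ofAssociativeRing

open scoped TensorProduct

/-! ## Words in a family of elements of a Lie algebra -/

section Words

variable {R L M ι : Type*} [CommRing R] [LieRing L] [LieAlgebra R L]
  [AddCommGroup M] [Module R M] [LieRingModule L M] [LieModule R L M]

/-- The composition of the actions on `M` of the members of the family `X` listed in `l`. -/
def lieWord (R : Type*) {L M ι : Type*} [CommRing R] [LieRing L] [LieAlgebra R L]
    [AddCommGroup M] [Module R M] [LieRingModule L M] [LieModule R L M]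
    (X : ι → L) (l : List ι) : M →ₗ[R] M :=
  (l.map fun a => LieModule.toEnd R L M (X a)).prod

@[simp] theorem lieWord_nil (X : ι → L) (m : M) : lieWord R X [] m = m := rfl

@[simp] theorem lieWord_cons (X : ι → L) (a : ι) (l : List ι) (m : M) :
    lieWord R X (a :: l) m = ⁅X a, lieWord R X l m⁆ := by
  simp [lieWord]

theorem map_lieWord {M' : Type*} [AddCommGroup M'] [Module R M'] [LieRingModule L M']
    [LieModule R L M'] (f : M →ₗ⁅R, L⁆ M') (X : ι → L) (l : List ι) (m : M) :
    f (lieWord R X l m) = lieWord R X l (f m) := by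
  induction l with
  | nil => rfl
  | cons a l ih => simp [ih]

/-! ### Sorted words span -/

/-- The span of the words of length at most `r` applied to `V`. -/
def wordsOfLengthLE (X : ι → L) (V : Submodule R M) (r : ℕ) : Submodule R M :=
  Submodule.span R {m | ∃ l : List ι, ∃ v ∈ V, l.length ≤ r ∧ lieWord R X l v = m}

theorem lieWord_mem_wordsOfLengthLE (X : ι → L) {V : Submodule R M} {r : ℕ} {l : List ι}
    (hl : l.length ≤ r) {v : M} (hv : v ∈ V) : lieWord R X l v ∈ wordsOfLengthLE X V r :=
  Submodule.subset_span ⟨l, v, hv, hl, rfl⟩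

theorem wordsOfLengthLE_mono (X : ι → L) (V : Submodule R M) :
    Monotone (wordsOfLengthLE X V) := by
  intro r r' h
  refine Submodule.span_mono ?_
  rintro _ ⟨l, v, hv, hl, rfl⟩
  exact ⟨l, v, hv, hl.trans h, rfl⟩

theorem lie_mem_wordsOfLengthLE_succ (X : ι → L) {V : Submodule R M} {r : ℕ} (a : ι) {m : M}
    (hm : m ∈ wordsOfLengthLE X V r) : ⁅X a, m⁆ ∈ wordsOfLengthLE X V (r + 1) := by
  induction hm using Submodule.span_induction with
  | mem m hm =>
    obtain ⟨l, v, hv, hl, rfl⟩ := hm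
    rw [← lieWord_cons (R := R)]
    exact lieWord_mem_wordsOfLengthLE X (by simpa using hl) hv
  | zero => simp
  | add m n _ _ h1 h2 => rw [lie_add]; exact add_mem h1 h2
  | smul c m _ h => rw [lie_smul]; exact Submodule.smul_mem _ c h

variable {X : ι → L} {V : Submodule R M} {H : Submodule R L}

/-- Commute `y` to the right through the word: each commutator is again a single element facing a
shorter word. On reaching `V`, its part in `H` is absorbed and its part in the span of `X` adds one
letter. -/
theorem lie_lieWord_mem (hH : H ⊔ Submodule.span R (Set.range X) = ⊤)
    (hV : ∀ y ∈ H, ∀ v ∈ V, ⁅y, v⁆ ∈ V) (y : L) (l : List ι) {v : M} (hv : v ∈ V) :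
    ⁅y, lieWord R X l v⁆ ∈ wordsOfLengthLE X V (l.length + 1) := by
  induction l generalizing y with
  | nil =>
    have hy : y ∈ H ⊔ Submodule.span R (Set.range X) := hH ▸ Submodule.mem_top
    obtain ⟨h, hh, x, hx, rfl⟩ := Submodule.mem_sup.mp hy
    rw [lieWord_nil, add_lie]
    refine add_mem (lieWord_mem_wordsOfLengthLE X (l := []) (by simp) (hV h hh v hv)) ?_
    clear hy
    induction hx using Submodule.span_induction with
    | mem x hx =>
      obtain ⟨a, rfl⟩ := hx
      exact lieWord_mem_wordsOfLengthLE X (l := [a]) (by simp) hv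
    | zero => simp
    | add x z _ _ h1 h2 => rw [add_lie]; exact add_mem h1 h2
    | smul c x _ h => rw [smul_lie]; exact Submodule.smul_mem _ c h
  | cons a l ih =>
    rw [lieWord_cons, leibniz_lie, List.length_cons]
    exact add_mem (wordsOfLengthLE_mono X V (Nat.le_succ _) (ih _))
      (lie_mem_wordsOfLengthLE_succ X a (ih y))

/-- Swapping two adjacent letters costs one commutator, which replaces two letters by a single Lie
algebra element and so yields words shorter by one. -/
theorem lieWord_sub_lieWord_mem_of_perm (hH : H ⊔ Submodule.span R (Set.range X) = ⊤)
    (hV : ∀ y ∈ H, ∀ v ∈ V, ⁅y, v⁆ ∈ V) {l l' : List ι} (h : l.Perm l') {v : M} (hv : v ∈ V)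
    {r : ℕ} (hr : l.length ≤ r + 1) :
    lieWord R X l v - lieWord R X l' v ∈ wordsOfLengthLE X V r := by
  induction h generalizing r with
  | nil => simp
  | @cons a l l' h ih =>
    rw [List.length_cons, Nat.add_le_add_iff_right] at hr
    rw [lieWord_cons, lieWord_cons, ← lie_sub]
    cases r with
    | zero =>
      obtain rfl := List.length_eq_zero_iff.mp (Nat.le_zero.mp hr)
      obtain rfl := h.nil_eq
      simp
    | succ r => exact lie_mem_wordsOfLengthLE_succ X a (ih hr)
  | swap a b l =>
    simp only [lieWord_cons, leibniz_lie (X b) (X a), add_sub_cancel_right]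
    exact wordsOfLengthLE_mono X V (by simpa using hr) (lie_lieWord_mem hH hV _ l hv)
  | trans h1 h2 ih1 ih2 =>
    rw [← sub_add_sub_cancel]
    exact add_mem (ih1 hr) (ih2 (h1.length_eq ▸ hr))

variable [LinearOrder ι]

/-- The linear map sending a finitely supported family `(v_s)` of elements of `V`, indexed by
multisets, to the sum of the `X_{a_1} ⋯ X_{a_r} v_s` with `a_1 ≤ ⋯ ≤ a_r` the sorted list of `s`. -/
def sortedWordMap (X : ι → L) (V : Submodule R M) : (Multiset ι →₀ V) →ₗ[R] M :=
  Finsupp.lsum R fun s => lieWord R X s.sort ∘ₗ V.subtype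

@[simp] theorem sortedWordMap_single (X : ι → L) (V : Submodule R M) (s : Multiset ι) (v : V) :
    sortedWordMap X V (Finsupp.single s v) = lieWord R X s.sort (v : M) := by
  simp [sortedWordMap]

theorem wordsOfLengthLE_le_range (hH : H ⊔ Submodule.span R (Set.range X) = ⊤)
    (hV : ∀ y ∈ H, ∀ v ∈ V, ⁅y, v⁆ ∈ V) (r : ℕ) :
    wordsOfLengthLE X V r ≤ LinearMap.range (sortedWordMap X V) := by
  have hsort : ∀ (l : List ι) (v : M), v ∈ V →
      lieWord R X (l : Multiset ι).sort v ∈ LinearMap.range (sortedWordMap X V) :=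
    fun l v hv => ⟨Finsupp.single (l : Multiset ι) ⟨v, hv⟩, by simp⟩
  induction r with
  | zero =>
    refine Submodule.span_le.mpr ?_
    rintro _ ⟨l, v, hv, hl, rfl⟩
    obtain rfl := List.length_eq_zero_iff.mp (Nat.le_zero.mp hl)
    simpa using hsort [] v hv
  | succ r ih =>
    refine Submodule.span_le.mpr ?_
    rintro _ ⟨l, v, hv, hl, rfl⟩
    have hp : l.Perm (l : Multiset ι).sort := by
      rw [← Multiset.coe_eq_coe, Multiset.sort_eq]
    have := add_mem (ih (lieWord_sub_lieWord_mem_of_perm hH hV hp hv hl)) (hsort l v hv)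
    rwa [sub_add_cancel] at this

/-- The spanning half of the Poincaré-Birkhoff-Witt theorem, for a module generated by a subspace
stable under `H`, where `X` spans a complement of `H`. -/
theorem sortedWordMap_surjective (hH : H ⊔ Submodule.span R (Set.range X) = ⊤)
    (hV : ∀ y ∈ H, ∀ v ∈ V, ⁅y, v⁆ ∈ V)
    (hgen : ∀ N : LieSubmodule R L M, V ≤ N.toSubmodule → N = ⊤) :
    Function.Surjective (sortedWordMap X V) := by
  -- The unsorted words on `V` already span a submodule, so by generation they span everything;
  -- sorting is then done by induction on length.
  let N : LieSubmodule R L M :=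
    { __ := Submodule.span R {m | ∃ l : List ι, ∃ v ∈ V, lieWord R X l v = m}
      lie_mem := by
        intro y m hm
        change m ∈ Submodule.span R _ at hm
        change ⁅y, m⁆ ∈ Submodule.span R _
        induction hm using Submodule.span_induction with
        | mem m hm =>
          obtain ⟨l, v, hv, rfl⟩ := hm
          refine Submodule.span_mono ?_ (lie_lieWord_mem hH hV y l hv)
          rintro _ ⟨l, v, hv, -, rfl⟩
          exact ⟨l, v, hv, rfl⟩
        | zero => simp
        | add m n _ _ h1 h2 => rw [lie_add]; exact add_mem h1 h2
        | smul c m _ h => rw [lie_smul]; exact Submodule.smul_mem _ c h }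
  have hN : N = ⊤ := hgen N fun v hv => Submodule.subset_span ⟨[], v, hv, rfl⟩
  have hle : N.toSubmodule ≤ LinearMap.range (sortedWordMap X V) := by
    refine Submodule.span_le.mpr ?_
    rintro _ ⟨l, v, hv, rfl⟩
    exact wordsOfLengthLE_le_range hH hV l.length (lieWord_mem_wordsOfLengthLE X le_rfl hv)
  rw [← LinearMap.range_eq_top, eq_top_iff]
  rwa [hN] at hle

end Words

/-! ## Independence of sorted words -/

section Independence

variable {R L M ι : Type*} [CommRing R] [LieRing L] [LieAlgebra R L]
  [AddCommGroup M] [Module R M] [LieRingModule L M] [LieModule R L M]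

/-- The total weight of a list of labels. -/
def listWeight (wt : ι → ℕ) (l : List ι) : ℤ := (l.map fun a => (wt a : ℤ)).sum

@[simp] theorem listWeight_nil (wt : ι → ℕ) : listWeight wt [] = 0 := rfl

@[simp] theorem listWeight_cons (wt : ι → ℕ) (a : ι) (l : List ι) :
    listWeight wt (a :: l) = wt a + listWeight wt l := by simp [listWeight]

/-- The span of the words of weight at most `w` applied to `V`. -/
def wordsOfWeightLE (X : ι → L) (wt : ι → ℕ) (V : Submodule R M) (w : ℤ) : Submodule R M :=
  Submodule.span R {m | ∃ l : List ι, ∃ v ∈ V, listWeight wt l ≤ w ∧ lieWord R X l v = m}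

/-- A family `X` of elements of a Lie algebra acting on a module with a subspace `V`, together with
two descending filtrations `E` and `D` of the Lie algebra that are shifted by bracketing with `X a`
by the weight of `X a`; `E 0` stabilizes `V`, and `D n` kills `V` for `n ≥ 1`. -/
structure IsWeighted (X : ι → L) (wt : ι → ℕ) (V : Submodule R M) (E D : ℤ → Submodule R L) :
    Prop where
  wt_pos : ∀ a, 1 ≤ wt a
  antitone : Antitone E
  le_sup : ∀ n ≤ 0, E n ≤ E 0 ⊔ Submodule.span R {x | ∃ a, (wt a : ℤ) ≤ -n ∧ X a = x}
  lie_mem_E : ∀ n a, ∀ y ∈ E n, ⁅y, X a⁆ ∈ E (n - wt a)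
  lie_mem : ∀ y ∈ E 0, ∀ v ∈ V, ⁅y, v⁆ ∈ V
  D_le : ∀ n, D n ≤ E (n + 1)
  lie_mem_D : ∀ n a, ∀ y ∈ D n, ⁅y, X a⁆ ∈ D (n - wt a)
  lie_eq_zero : ∀ n, 1 ≤ n → ∀ y ∈ D n, ∀ v ∈ V, ⁅y, v⁆ = 0

variable {X : ι → L} {wt : ι → ℕ} {V : Submodule R M} {E D : ℤ → Submodule R L}

theorem listWeight_nonneg (wt : ι → ℕ) (l : List ι) : 0 ≤ listWeight wt l := by
  induction l with
  | nil => simp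
  | cons a l ih => rw [listWeight_cons]; positivity

theorem listWeight_perm {l l' : List ι} (h : l.Perm l') : listWeight wt l = listWeight wt l' :=
  (h.map _).sum_eq

theorem sort_erase [LinearOrder ι] (s : Multiset ι) (a : ι) :
    (s.erase a).sort = s.sort.erase a := by
  refine List.Perm.eq_of_pairwise' (r := (· ≤ ·)) (Multiset.pairwise_sort ..)
    ((Multiset.pairwise_sort ..).sublist List.erase_sublist) ?_
  rw [← Multiset.coe_eq_coe, ← Multiset.coe_erase, Multiset.sort_eq, Multiset.sort_eq]

theorem lieWord_mem_wordsOfWeightLE {w : ℤ} {l : List ι} (hl : listWeight wt l ≤ w) {v : M}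
    (hv : v ∈ V) : lieWord R X l v ∈ wordsOfWeightLE X wt V w :=
  Submodule.subset_span ⟨l, v, hv, hl, rfl⟩

theorem wordsOfWeightLE_mono : Monotone (wordsOfWeightLE X wt V) := by
  intro w w' h
  refine Submodule.span_mono ?_
  rintro _ ⟨l, v, hv, hl, rfl⟩
  exact ⟨l, v, hv, hl.trans h, rfl⟩

theorem wordsOfWeightLE_eq_bot {w : ℤ} (hw : w < 0) : wordsOfWeightLE X wt V w = ⊥ := by
  rw [wordsOfWeightLE, Submodule.span_eq_bot]
  rintro _ ⟨l, v, -, hl, rfl⟩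
  exact absurd (listWeight_nonneg wt l) (by omega)

theorem lie_mem_wordsOfWeightLE {w : ℤ} (a : ι) {m : M} (hm : m ∈ wordsOfWeightLE X wt V w) :
    ⁅X a, m⁆ ∈ wordsOfWeightLE X wt V (wt a + w) := by
  induction hm using Submodule.span_induction with
  | mem m hm =>
    obtain ⟨l, v, hv, hl, rfl⟩ := hm
    rw [← lieWord_cons (R := R)]
    exact lieWord_mem_wordsOfWeightLE (by simpa using hl) hv
  | zero => simp
  | add m n _ _ h1 h2 => rw [lie_add]; exact add_mem h1 h2
  | smul c m _ h => rw [lie_smul]; exact Submodule.smul_mem _ c h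

/-! ### Leading terms and independence of weighted words -/

namespace IsWeighted

/-- An element of degree at least `n` raises weight by at most `-n`. This needs `n ≤ 0`: an element
of positive degree may act on `V` without lowering the weight, which is already zero. -/
theorem lie_lieWord_mem_of_mem_E (h : IsWeighted X wt V E D) {n : ℤ} (hn : n ≤ 0) {y : L}
    (hy : y ∈ E n) (l : List ι) {v : M} (hv : v ∈ V) :
    ⁅y, lieWord R X l v⁆ ∈ wordsOfWeightLE X wt V (listWeight wt l - n) := by
  induction l generalizing n y with
  | nil =>
    obtain ⟨y₀, hy₀, x, hx, rfl⟩ := Submodule.mem_sup.mp (h.le_sup n hn hy)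
    clear hy
    rw [lieWord_nil, add_lie]
    refine add_mem (lieWord_mem_wordsOfWeightLE (l := []) (by simpa) (h.lie_mem y₀ hy₀ v hv)) ?_
    induction hx using Submodule.span_induction with
    | mem x hx =>
      obtain ⟨a, ha, rfl⟩ := hx
      exact lieWord_mem_wordsOfWeightLE (l := [a]) (by simpa using ha) hv
    | zero => simp
    | add x z _ _ h1 h2 => rw [add_lie]; exact add_mem h1 h2
    | smul c x _ h => rw [smul_lie]; exact Submodule.smul_mem _ c h
  | cons a l ih =>
    rw [lieWord_cons, leibniz_lie, listWeight_cons]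
    refine add_mem (wordsOfWeightLE_mono ?_ (ih (n := n - wt a) ?_ (h.lie_mem_E n a y hy)))
      (wordsOfWeightLE_mono ?_ (lie_mem_wordsOfWeightLE a (ih hn hy))) <;> omega

/-- In `D` the weight bound holds for positive `n` too, since such elements kill `V`. Once
commutators bring the index down to `n ≤ 0`, the inclusion `D n ≤ E (n + 1)` returns to the previous
case. -/
theorem lie_lieWord_mem_of_mem_D (h : IsWeighted X wt V E D) {n : ℤ} {y : L}
    (hy : y ∈ D n) (l : List ι) {v : M} (hv : v ∈ V) :
    ⁅y, lieWord R X l v⁆ ∈ wordsOfWeightLE X wt V (listWeight wt l - n) := by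
  by_cases hn : n ≤ 0
  · exact h.lie_lieWord_mem_of_mem_E hn (h.antitone (by omega) (h.D_le n hy)) l hv
  induction l generalizing n y with
  | nil =>
    rw [lieWord_nil, h.lie_eq_zero n (by omega) y hy v hv]
    exact zero_mem _
  | cons a l ih =>
    rw [lieWord_cons, leibniz_lie, listWeight_cons]
    have hya := h.lie_mem_D n a y hy
    have h1 : ⁅⁅y, X a⁆, lieWord R X l v⁆ ∈
        wordsOfWeightLE X wt V (listWeight wt l - (n - wt a)) := by
      by_cases hna : n - wt a ≤ 0
      · exact h.lie_lieWord_mem_of_mem_E hna (h.antitone (by omega) (h.D_le _ hya)) l hv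
      · exact ih hya hna
    exact add_mem (wordsOfWeightLE_mono (by omega) h1)
      (wordsOfWeightLE_mono (by omega) (lie_mem_wordsOfWeightLE a (ih hy hn)))

theorem lie_mem_of_mem_D (h : IsWeighted X wt V E D) {n w : ℤ} {y : L} (hy : y ∈ D n) {m : M}
    (hm : m ∈ wordsOfWeightLE X wt V w) : ⁅y, m⁆ ∈ wordsOfWeightLE X wt V (w - n) := by
  induction hm using Submodule.span_induction with
  | mem m hm =>
    obtain ⟨l, v, hv, hl, rfl⟩ := hm
    exact wordsOfWeightLE_mono (by omega) (h.lie_lieWord_mem_of_mem_D hy l hv)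
  | zero => simp
  | add m n _ _ h1 h2 => rw [lie_add]; exact add_mem h1 h2
  | smul c m _ h => rw [lie_smul]; exact Submodule.smul_mem _ c h

/-- Passing `y` through `X a` removes weight `wt a` and leaves a commutator in `E (1 - wt a)`, which
restores at most `wt a - 1`. So `y` commutes with words modulo smaller weight. -/
theorem lie_lieWord_sub_lieWord_lie_mem (h : IsWeighted X wt V E D) {y : L} (hy : y ∈ E 1)
    (l : List ι) {v : M} (hv : v ∈ V) :
    ⁅y, lieWord R X l v⁆ - lieWord R X l ⁅y, v⁆ ∈
      wordsOfWeightLE X wt V (listWeight wt l - 1) := by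
  induction l with
  | nil => simp
  | cons a l ih =>
    rw [lieWord_cons, lieWord_cons, leibniz_lie, add_sub_assoc, ← lie_sub, listWeight_cons]
    have ha := h.wt_pos a
    refine add_mem (wordsOfWeightLE_mono ?_
      (h.lie_lieWord_mem_of_mem_E (n := 1 - wt a) ?_ (h.lie_mem_E 1 a y hy) l hv))
      (wordsOfWeightLE_mono ?_ (lie_mem_wordsOfWeightLE a ih)) <;> omega

variable [LinearOrder ι]

/-- The leading term of the action of `x ∈ D (wt a)` on a sorted word of letters of weight at least
`wt a`, in which `a` is the only letter of weight `wt a` that interacts with `x`. -/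
theorem lie_lieWord_sub_leading_mem (h : IsWeighted X wt V E D) {a : ι} {x : L}
    (hx : x ∈ D (wt a)) {l : List ι} (hl : l.Pairwise (· ≤ ·)) (hwt : ∀ b ∈ l, wt a ≤ wt b)
    {v : M} (hv : v ∈ V) (hxb : ∀ b ∈ l, b ≠ a → wt b = wt a → ⁅⁅x, X b⁆, v⁆ = 0) :
    ⁅x, lieWord R X l v⁆ - l.count a • lieWord R X (l.erase a) ⁅⁅x, X a⁆, v⁆ ∈
      wordsOfWeightLE X wt V (listWeight wt l - wt a - 1) := by
  have hone : ∀ b, wt b = wt a → ⁅x, X b⁆ ∈ E 1 := fun b hb => by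
    have := h.D_le _ (h.lie_mem_D _ b x hx)
    rwa [hb, sub_self, zero_add] at this
  induction l with
  | nil =>
    have := h.wt_pos a
    simp [h.lie_eq_zero (wt a) (by omega) x hx v hv]
  | cons b l ih =>
    rw [List.pairwise_cons] at hl
    have ih' := lie_mem_wordsOfWeightLE b
      (ih hl.2 (fun c hc => hwt c (by simp [hc])) (fun c hc => hxb c (by simp [hc])))
    rw [lie_sub, lie_nsmul] at ih'
    rw [lieWord_cons, leibniz_lie, listWeight_cons]
    by_cases hba : b = a
    · subst hba
      -- Sortedness is used only here: `b` is at most every later letter, so putting `b` in front of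
      -- `l.erase b` gives back `l` itself when `b ∈ l`.
      have hcount : l.count b • ⁅X b, lieWord R X (l.erase b) ⁅⁅x, X b⁆, v⁆⁆ =
          l.count b • lieWord R X l ⁅⁅x, X b⁆, v⁆ := by
        by_cases hb : b ∈ l
        · have : b :: l.erase b = l :=
            (List.perm_cons_erase hb).symm.eq_of_pairwise' (r := (· ≤ ·))
              (List.pairwise_cons.mpr
                ⟨fun c hc => hl.1 c (List.mem_of_mem_erase hc), hl.2.sublist List.erase_sublist⟩)
              hl.2
          rw [← lieWord_cons (R := R), this]
        · simp [List.count_eq_zero_of_not_mem hb]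
      rw [hcount] at ih'
      rw [List.count_cons_self, List.erase_cons_head, succ_nsmul']
      have h3 := h.lie_lieWord_sub_lieWord_lie_mem (hone b rfl) l hv
      convert add_mem (wordsOfWeightLE_mono ?_ h3) (wordsOfWeightLE_mono ?_ ih') using 1
      · abel
      · omega
      · omega
    · rw [List.count_cons_of_ne hba, List.erase_cons_tail (by simpa using hba), lieWord_cons,
        add_sub_assoc ⁅⁅x, X b⁆, lieWord R X l v⁆]
      refine add_mem ?_ (wordsOfWeightLE_mono (by omega) ih')
      rcases (hwt b (by simp)).eq_or_lt with hb | hb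
      · have h3 := h.lie_lieWord_sub_lieWord_lie_mem (hone b hb.symm) l hv
        rw [hxb b (by simp) hba hb.symm, map_zero, sub_zero] at h3
        exact wordsOfWeightLE_mono (by omega) h3
      -- A strictly heavier letter contributes nothing: its commutator with `x` lies in `E (wt a -
      -- wt b + 1)` and restores at most `wt b - wt a - 1`, one less than the leading weight
      -- requires.
      · have hE := h.D_le _ (h.lie_mem_D _ b x hx)
        have h3 := h.lie_lieWord_mem_of_mem_E (n := wt a - wt b + 1) (by omega) hE l hv
        exact wordsOfWeightLE_mono (by omega) h3

/-- A combination of words of exact weight `w` cannot cancel down to smaller weight. The element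
dual to a minimal letter `a` turns `P` into its formal derivative `Q`, to which induction on `w`
applies. -/
theorem eq_zero_of_sortedWordMap_mem (h : IsWeighted X wt V E D) (rk : ι → ℕ)
    [IsAddTorsionFree M]
    (hdual : ∀ a, ∃ x ∈ D (wt a), (∀ v ∈ V, ⁅⁅x, X a⁆, v⁆ = 0 → v = 0) ∧
      ∀ b ≠ a, wt b = wt a → rk a ≤ rk b → ∀ v ∈ V, ⁅⁅x, X b⁆, v⁆ = 0)
    (w : ℕ) (P : Multiset ι →₀ V) (hP : ∀ s ∈ P.support, listWeight wt s.sort = w)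
    (hmem : sortedWordMap X V P ∈ wordsOfWeightLE X wt V (w - 1)) : P = 0 := by
  induction w using Nat.strong_induction_on generalizing P with
  | _ w ih =>
  by_contra hP0
  by_cases hlet : ∃ a, ∃ s ∈ P.support, a ∈ s
  · -- a letter with the least weight, and of least rank among these
    let f : ι → ℕ ×ₗ ℕ := fun a => toLex (wt a, rk a)
    obtain ⟨a, ⟨s₀, hs₀, has₀⟩, hmin⟩ := (InvImage.wf f wellFounded_lt).has_min
      {a | ∃ s ∈ P.support, a ∈ s} hlet
    have hmin' : ∀ s ∈ P.support, ∀ b ∈ s, wt a < wt b ∨ wt a = wt b ∧ rk a ≤ rk b := by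
      intro s hs b hb
      have := hmin b ⟨s, hs, hb⟩
      simp only [InvImage, f, not_lt, Prod.Lex.toLex_le_toLex] at this
      exact this
    obtain ⟨x, hx, hinj, hother⟩ := hdual a
    have hxaV : ∀ v ∈ V, ⁅⁅x, X a⁆, v⁆ ∈ V := by
      have := h.D_le _ (h.lie_mem_D _ a x hx)
      exact h.lie_mem _ (h.antitone (by omega) this)
    let T : V →ₗ[R] V := (LieModule.toEnd R L M ⁅x, X a⁆).restrict hxaV
    have hT : ∀ v : V, ((T v : V) : M) = ⁅⁅x, X a⁆, (v : M)⁆ := fun v => rfl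
    let Q : Multiset ι →₀ V := P.sum fun s v => Finsupp.single (s.erase a) (s.count a • T v)
    -- Terms without `a` vanish because their count is zero, and erasing `a` is injective on
    -- multisets containing it, so only `a ::ₘ N` contributes.
    have hQN : ∀ N, Q N = (a ::ₘ N).count a • T (P (a ::ₘ N)) := by
      intro N
      simp only [Q, Finsupp.sum, Finsupp.finsetSum_apply]
      rw [Finset.sum_eq_single (a ::ₘ N)]
      · simp
      · intro s _ hs
        by_cases has : a ∈ s
        · refine Finsupp.single_eq_of_ne fun hN => hs ?_
          rw [hN, Multiset.cons_erase has]
        · simp [Multiset.count_eq_zero_of_notMem has]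
      · intro hs
        simp [Finsupp.notMem_support_iff.mp hs]
    have hwa : ∀ s : Multiset ι, a ∈ s →
        listWeight wt s.sort = wt a + listWeight wt (s.erase a).sort := by
      intro s has
      rw [← listWeight_cons]
      refine listWeight_perm ?_
      rw [← Multiset.coe_eq_coe, ← Multiset.cons_coe, Multiset.sort_eq, Multiset.sort_eq,
        Multiset.cons_erase has]
    have hwle : wt a ≤ w := by
      have h1 := hP s₀ hs₀
      have h2 := hwa s₀ has₀
      have h3 := listWeight_nonneg wt (s₀.erase a).sort
      omega
    have hlead : ⁅x, sortedWordMap X V P⁆ - sortedWordMap X V Q ∈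
        wordsOfWeightLE X wt V (w - wt a - 1) := by
      have e1 : ⁅x, sortedWordMap X V P⁆ - sortedWordMap X V Q =
          ∑ s ∈ P.support, (⁅x, lieWord R X s.sort (P s : M)⁆ -
            s.sort.count a • lieWord R X (s.sort.erase a) ⁅⁅x, X a⁆, (P s : M)⁆) := by
        rw [Finset.sum_sub_distrib]
        congr 1
        · rw [sortedWordMap, Finsupp.lsum_apply, Finsupp.sum, ← LieModule.toEnd_apply_apply R L M,
            map_sum]
          rfl
        · simp only [Q, Finsupp.sum, map_sum, sortedWordMap_single]
          refine Finset.sum_congr rfl fun s _ => ?_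
          rw [← Multiset.coe_count, Multiset.sort_eq, AddSubmonoidClass.coe_nsmul, map_nsmul, hT,
            sort_erase]
      rw [e1]
      refine sum_mem fun s hs => ?_
      rw [← hP s hs]
      refine h.lie_lieWord_sub_leading_mem hx (Multiset.pairwise_sort ..) ?_ (P s).2 ?_
      · intro b hb
        rcases hmin' s hs b (by simpa using hb) with h1 | h1 <;> omega
      · intro b hb hba hwb
        rcases hmin' s hs b (by simpa using hb) with h1 | h1
        · omega
        · exact hother b hba hwb h1.2 _ (P s).2
    have hQ0 : Q = 0 := by
      refine ih (w - wt a) (by have := h.wt_pos a; omega) Q ?_ ?_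
      · intro N hN
        rw [Finsupp.mem_support_iff, hQN] at hN
        have hs : a ::ₘ N ∈ P.support := by
          rw [Finsupp.mem_support_iff]
          intro h0
          simp [h0] at hN
        have h1 := hwa (a ::ₘ N) (by simp)
        rw [hP _ hs, Multiset.erase_cons_head] at h1
        omega
      -- The relation has weight at most `w - 1`, and `x` lowers weight by at least `wt a`;
      -- subtracting the leading-term error leaves `Q` in weight below `w - wt a`.
      · have h2 := h.lie_mem_of_mem_D hx hmem
        have h3 := sub_mem (wordsOfWeightLE_mono (by omega) h2) hlead
        rw [sub_sub_cancel] at h3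
        exact wordsOfWeightLE_mono (by omega) h3
    -- The derivative vanishes at `s₀.erase a`, so a nonzero multiple of `[x, X a]` applied to `P
    -- s₀` is zero; torsion-freeness and injectivity then contradict `s₀ ∈ P.support`.
    have h0 := hQN (s₀.erase a)
    rw [hQ0, Multiset.cons_erase has₀, Finsupp.zero_apply] at h0
    have h1 : s₀.count a • ⁅⁅x, X a⁆, (P s₀ : M)⁆ = 0 := by
      rw [← hT]
      exact congrArg Subtype.val h0.symm
    have h2 := (nsmul_eq_zero_iff_right (Multiset.count_ne_zero.mpr has₀)).mp h1
    exact (Finsupp.mem_support_iff.mp hs₀) (Subtype.ext (hinj _ (P s₀).2 h2))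
  -- Without letters only the empty word remains, so `w = 0`, and there is nothing of negative
  -- weight.
  · push Not at hlet
    have hs : ∀ s ∈ P.support, s = 0 := fun s hs =>
      Multiset.eq_zero_of_forall_notMem fun a ha => hlet a s hs ha
    have hP' : P = Finsupp.single 0 (P 0) := by
      ext s
      by_cases h0 : s = 0
      · simp [h0]
      · rw [Finsupp.single_eq_of_ne h0, Finsupp.notMem_support_iff.mp fun h1 => h0 (hs s h1)]
    have h0 : (0 : Multiset ι) ∈ P.support := by
      obtain ⟨s, hs'⟩ := Finsupp.support_nonempty_iff.mpr hP0
      rwa [← hs s hs']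
    have hw : w = 0 := by simpa [eq_comm] using hP 0 h0
    rw [hP', wordsOfWeightLE_eq_bot (by omega), Submodule.mem_bot, sortedWordMap_single] at hmem
    exact (Finsupp.mem_support_iff.mp h0) (Subtype.ext (by simpa using hmem))

/-- In a relation, the part of greatest weight equals minus the rest, which has smaller weight;
hence that part is zero. -/
theorem sortedWordMap_injective (h : IsWeighted X wt V E D) (rk : ι → ℕ) [IsAddTorsionFree M]
    (hdual : ∀ a, ∃ x ∈ D (wt a), (∀ v ∈ V, ⁅⁅x, X a⁆, v⁆ = 0 → v = 0) ∧
      ∀ b ≠ a, wt b = wt a → rk a ≤ rk b → ∀ v ∈ V, ⁅⁅x, X b⁆, v⁆ = 0) :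
    Function.Injective (sortedWordMap X V) := by
  rw [injective_iff_map_eq_zero]
  intro P hP
  by_contra hP0
  obtain ⟨s₀, hs₀, hmax⟩ := P.support.exists_max_image
    (fun s : Multiset ι => listWeight wt (s.sort (· ≤ ·))) (Finsupp.support_nonempty_iff.mpr hP0)
  obtain ⟨w, hw⟩ := Int.eq_ofNat_of_zero_le (listWeight_nonneg wt s₀.sort)
  simp only [hw] at hmax
  have hadd := P.filter_add_filter_not (fun s : Multiset ι => listWeight wt s.sort = w)
  have hz : P.filter (fun s : Multiset ι => listWeight wt s.sort = w) = 0 := by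
    refine h.eq_zero_of_sortedWordMap_mem rk hdual w _ ?_ ?_
    · intro s hs
      rw [Finsupp.support_filter, Finset.mem_filter] at hs
      exact hs.2
    · rw [← hadd, map_add, add_eq_zero_iff_eq_neg] at hP
      rw [hP]
      refine neg_mem ?_
      rw [sortedWordMap, Finsupp.lsum_apply, Finsupp.sum]
      refine sum_mem fun s hs => lieWord_mem_wordsOfWeightLE ?_ (Subtype.prop _)
      rw [Finsupp.support_filter, Finset.mem_filter] at hs
      have := hmax s hs.1
      omega
  have := DFunLike.congr_fun hz s₀
  rw [Finsupp.filter_apply_pos (fun s : Multiset ι => listWeight wt (s.sort (· ≤ ·)) = w) P hw]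
    at this
  exact (Finsupp.mem_support_iff.mp hs₀) this

end IsWeighted

end Independence

/-! ## Maps out of induced modules -/

section InducedLift

-- The elements satisfying `p` form a subalgebra containing the image of `L`. The universal property
-- gives a map into it, whose composite with the inclusion is the identity by uniqueness.
open UniversalEnvelopingAlgebra in
theorem envelopingAlgebra_induction {R L : Type*} [CommRing R] [LieRing L] [LieAlgebra R L]
    {p : UniversalEnvelopingAlgebra R L → Prop}
    (algebraMap : ∀ r, p (algebraMap R (UniversalEnvelopingAlgebra R L) r))
    (ι : ∀ x, p (ι R x)) (mul : ∀ a b, p a → p b → p (a * b))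
    (add : ∀ a b, p a → p b → p (a + b)) (u : UniversalEnvelopingAlgebra R L) : p u := by
  let s : Subalgebra R (UniversalEnvelopingAlgebra R L) :=
    { carrier := {u | p u}
      mul_mem' := fun {a b} => mul a b
      add_mem' := fun {a b} => add a b
      algebraMap_mem' := algebraMap }
  let f : L →ₗ⁅R⁆ s :=
    { toFun := fun x => ⟨UniversalEnvelopingAlgebra.ι R x, ι x⟩
      map_add' := fun x y => Subtype.ext (map_add (UniversalEnvelopingAlgebra.ι R) x y)
      map_smul' := fun c x => Subtype.ext (map_smul (UniversalEnvelopingAlgebra.ι R) c x)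
      map_lie' := fun {x y} =>
        Subtype.ext (by
          change UniversalEnvelopingAlgebra.ι R ⁅x, y⁆ = _ * _ - _ * _
          rw [LieHom.map_lie, LieRing.of_associative_ring_bracket]) }
  have h : s.val.comp (lift R f) = AlgHom.id R _ := by
    ext x
    change ((lift R f (UniversalEnvelopingAlgebra.ι R x) : s) : UniversalEnvelopingAlgebra R L) = _
    rw [lift_ι_apply]
    rfl
  have hu : ((lift R f u : s) : UniversalEnvelopingAlgebra R L) = u := DFunLike.congr_fun h u
  exact hu ▸ (lift R f u).2

variable {R L : Type*} [CommRing R] [LieRing L] [LieAlgebra R L] {H : LieSubalgebra R L}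
  {S : Type*} [AddCommGroup S] [Module R S] [LieRingModule L S] [LieModule R L S]
  (V : LieSubmodule R H S)

/-- This compatibility is what makes the relations defining the induced module vanish in `S`. -/
theorem envelopingAction_coe (h : UniversalEnvelopingAlgebra R H) (v : V) :
    ((envelopingAction R H V h v : V) : S) =
      UniversalEnvelopingAlgebra.lift R (LieModule.toEnd R L S) (envelopingIncl R H h) v := by
  induction h using envelopingAlgebra_induction generalizing v with
  | algebraMap r => simp only [AlgHom.commutes, Module.algebraMap_end_apply,
      LieSubmodule.coe_smul]
  | ι x =>
    rw [envelopingAction, envelopingIncl, UniversalEnvelopingAlgebra.lift_ι_apply,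
      UniversalEnvelopingAlgebra.lift_ι_apply]
    change _ = UniversalEnvelopingAlgebra.lift R (LieModule.toEnd R L S)
      (UniversalEnvelopingAlgebra.ι R (x : L)) v
    rw [UniversalEnvelopingAlgebra.lift_ι_apply]
    rfl
  | mul a b ha hb => rw [map_mul, map_mul, map_mul, Module.End.mul_apply, Module.End.mul_apply, ha, hb]
  | add a b ha hb => rw [map_add, map_add, map_add, LinearMap.add_apply, LinearMap.add_apply,
      LieSubmodule.coe_add, ha, hb]

/-- The action of `U(L)` on an `L`-module. -/
abbrev envelopingModule (R L S : Type*) [CommRing R] [LieRing L] [LieAlgebra R L]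
    [AddCommGroup S] [Module R S] [LieRingModule L S] [LieModule R L S] :
    Module (UniversalEnvelopingAlgebra R L) S :=
  Module.compHom S (UniversalEnvelopingAlgebra.lift R (LieModule.toEnd R L S)).toRingHom

/-- The canonical map `Ind_H^L(V) → S`, for an `H`-submodule `V` of an `L`-module `S`. -/
def inducedLift : InducedModule R H V →ₗ⁅R, L⁆ S :=
  letI := envelopingModule R L S
  haveI : IsScalarTower R (UniversalEnvelopingAlgebra R L) S :=
    ⟨fun r u m => by
      change UniversalEnvelopingAlgebra.lift R (LieModule.toEnd R L S) (r • u) m =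
        r • UniversalEnvelopingAlgebra.lift R (LieModule.toEnd R L S) u m
      rw [map_smul, LinearMap.smul_apply]⟩
  let f : UniversalEnvelopingAlgebra R L ⊗[R] V →ₗ[UniversalEnvelopingAlgebra R L] S :=
    TensorProduct.AlgebraTensorModule.lift
      { toFun := fun u => u • (V.toSubmodule.subtype : V →ₗ[R] S)
        map_add' := fun u u' => add_smul u u' _
        map_smul' := fun u u' => mul_smul u u' _ }
  let g : InducedModule R H V →ₗ[UniversalEnvelopingAlgebra R L] S :=
    (inducedRelations R H V).liftQ f (by
      refine Submodule.span_le.mpr ?_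
      rintro _ ⟨u, h, v, rfl⟩
      change f _ = 0
      rw [map_sub, sub_eq_zero]
      change UniversalEnvelopingAlgebra.lift R (LieModule.toEnd R L S) (u * envelopingIncl R H h) v
        = UniversalEnvelopingAlgebra.lift R (LieModule.toEnd R L S) u (envelopingAction R H V h v : V)
      rw [envelopingAction_coe, map_mul]
      rfl)
  { g.restrictScalars R with
    map_lie' := fun {x m} => by
      change g (UniversalEnvelopingAlgebra.ι R x • m) = ⁅x, g m⁆
      rw [map_smul]
      change UniversalEnvelopingAlgebra.lift R (LieModule.toEnd R L S)
        (UniversalEnvelopingAlgebra.ι R x) (g m) = _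
      rw [UniversalEnvelopingAlgebra.lift_ι_apply]
      rfl }

/-- The canonical map `V → Ind_H^L(V)`. -/
def toInduced (R : Type*) {L : Type*} [CommRing R] [LieRing L] [LieAlgebra R L]
    (H : LieSubalgebra R L) (V : Type*) [AddCommGroup V] [Module R V] [LieRingModule H V]
    [LieModule R H V] : V →ₗ[R] InducedModule R H V :=
  ((inducedRelations R H V).mkQ.restrictScalars R) ∘ₗ TensorProduct.mk R _ V 1

theorem inducedLift_toInduced (v : V) : inducedLift V (toInduced R H V v) = v := by
  change UniversalEnvelopingAlgebra.lift R (LieModule.toEnd R L S) 1 (v : S) = v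
  rw [map_one]
  rfl

section

variable {V : Type*} [AddCommGroup V] [Module R V] [LieRingModule H V] [LieModule R H V]

theorem lie_toInduced (y : H) (v : V) : ⁅(y : L), toInduced R H V v⁆ = toInduced R H V ⁅y, v⁆ := by
  change Submodule.Quotient.mk (UniversalEnvelopingAlgebra.ι R (y : L) • (1 ⊗ₜ[R] v)) =
    Submodule.Quotient.mk (1 ⊗ₜ[R] ⁅y, v⁆)
  rw [Submodule.Quotient.eq]
  refine Submodule.subset_span ⟨1, UniversalEnvelopingAlgebra.ι R y, v, ?_⟩
  rw [TensorProduct.smul_tmul', smul_eq_mul, mul_one, one_mul, envelopingIncl, envelopingAction,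
    UniversalEnvelopingAlgebra.lift_ι_apply, UniversalEnvelopingAlgebra.lift_ι_apply]
  rfl

theorem eq_top_of_range_toInduced_le (N : LieSubmodule R L (InducedModule R H V))
    (hN : LinearMap.range (toInduced R H V) ≤ N.toSubmodule) : N = ⊤ := by
  have hsmul : ∀ (u : UniversalEnvelopingAlgebra R L), ∀ m ∈ N, u • m ∈ N := by
    intro u
    induction u using envelopingAlgebra_induction with
    | algebraMap r =>
      intro m hm
      rw [algebraMap_smul]
      exact N.smul_mem r hm
    | ι x => exact fun m hm => N.lie_mem (x := x) hm
    | mul a b ha hb => exact fun m hm => mul_smul a b m ▸ ha _ (hb m hm)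
    | add a b ha hb => exact fun m hm => add_smul a b m ▸ add_mem (ha m hm) (hb m hm)
  rw [eq_top_iff]
  intro m _
  obtain ⟨t, rfl⟩ := Submodule.mkQ_surjective _ m
  induction t using TensorProduct.induction_on with
  | zero => rw [map_zero]; exact N.zero_mem
  | tmul u v =>
    have : (inducedRelations R H V).mkQ (u ⊗ₜ[R] v) = u • toInduced R H V v := by
      change _ = u • (inducedRelations R H V).mkQ (1 ⊗ₜ[R] v)
      rw [← map_smul, TensorProduct.smul_tmul', smul_eq_mul, mul_one]
    rw [this]
    exact hsmul u _ (hN ⟨v, rfl⟩)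
  | add a b ha hb => rw [map_add]; exact add_mem (ha trivial) (hb trivial)

end

/-! ### Irreducible modules generated by a subspace with independent sorted words -/

variable {ι : Type*} [LinearOrder ι] {X : ι → L}

omit [LieAlgebra R L] [LieModule R L S] in
theorem eq_top_of_le_of_isIrreducible (hS : LieModule.IsIrreducible R L S) {V : Submodule R S}
    (hV : V ≠ ⊥) (N : LieSubmodule R L S) (hN : V ≤ N.toSubmodule) : N = ⊤ := by
  refine (hS.eq_bot_or_eq_top N).resolve_left fun h => hV ?_
  rw [h] at hN
  exact le_bot_iff.mp hN

/-- Sorted words on the image of `V` span the induced module, and the canonical map carries them to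
independent words in `S`; this gives injectivity without independence in the enveloping algebra
being known beforehand. -/
theorem inducedLift_bijective (hS : LieModule.IsIrreducible R L S) (hV : V.toSubmodule ≠ ⊥)
    (hH : H.toSubmodule ⊔ Submodule.span R (Set.range X) = ⊤)
    (hinj : Function.Injective (sortedWordMap X V.toSubmodule)) :
    Function.Bijective (inducedLift V) := by
  constructor
  · let W : Submodule R (InducedModule R H V) := LinearMap.range (toInduced R H V)
    have hsurj : Function.Surjective (sortedWordMap X W) := by
      refine sortedWordMap_surjective hH ?_ eq_top_of_range_toInduced_le
      rintro y hy _ ⟨v, rfl⟩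
      exact ⟨⁅(⟨y, hy⟩ : H), v⁆, (lie_toInduced ⟨y, hy⟩ v).symm⟩
    let e : (Multiset ι →₀ V.toSubmodule) →ₗ[R] (Multiset ι →₀ W) :=
      Finsupp.mapRange.linearMap (toInduced R H V).rangeRestrict
    have he : Function.Surjective e :=
      Finsupp.mapRange_surjective _ (map_zero _) (toInduced R H V).surjective_rangeRestrict
    have hcomp : (inducedLift V : InducedModule R H V →ₗ[R] S) ∘ₗ sortedWordMap X W ∘ₗ e =
        sortedWordMap X V.toSubmodule := by
      ext s v
      simp only [e, LinearMap.comp_apply, Finsupp.lsingle_apply, Finsupp.mapRange.linearMap_apply,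
        Finsupp.mapRange_single, sortedWordMap_single]
      exact (map_lieWord (inducedLift V) X _ _).trans
        (congrArg _ (inducedLift_toInduced V v))
    have h1 : Function.Injective (inducedLift V ∘ (sortedWordMap X W ∘ e)) := by
      intro P Q hPQ
      exact hinj ((DFunLike.congr_fun hcomp P).symm.trans
        (Eq.trans hPQ (DFunLike.congr_fun hcomp Q)))
    exact h1.of_comp_right (hsurj.comp he)
  · rw [← LieModuleHom.range_eq_top]
    refine eq_top_of_le_of_isIrreducible hS hV _ fun v hv => ?_
    exact ⟨toInduced R H V ⟨v, hv⟩, inducedLift_toInduced V ⟨v, hv⟩⟩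

/-- A nonzero submodule of `V` generates `S`, so sorted words on it span `S`. By uniqueness of
coefficients, the expansion of `v ∈ V` must be the empty word applied to `v`. -/
theorem isIrreducible_of_sortedWordMap_injective (hS : LieModule.IsIrreducible R L S)
    (hV : V.toSubmodule ≠ ⊥) (hH : H.toSubmodule ⊔ Submodule.span R (Set.range X) = ⊤)
    (hinj : Function.Injective (sortedWordMap X V.toSubmodule)) :
    LieModule.IsIrreducible R H V := by
  have : Nontrivial V := Submodule.nontrivial_iff_ne_bot.mpr hV
  refine LieModule.IsIrreducible.mk fun N hN => ?_
  let W : Submodule R S := N.toSubmodule.map V.toSubmodule.subtype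
  have hW : W ≠ ⊥ := by
    intro h
    refine hN ((LieSubmodule.toSubmodule_eq_bot N).mp ?_)
    exact Submodule.map_injective_of_injective V.toSubmodule.subtype_injective
      (h.trans (Submodule.map_bot _).symm)
  have hWV : W ≤ V.toSubmodule := Submodule.map_subtype_le _ _
  have hsurj : Function.Surjective (sortedWordMap X W) := by
    refine sortedWordMap_surjective hH ?_ (eq_top_of_le_of_isIrreducible hS hW)
    rintro y hy _ ⟨v, hv, rfl⟩
    exact ⟨_, N.lie_mem (x := (⟨y, hy⟩ : H)) hv, rfl⟩
  rw [eq_top_iff]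
  intro v _
  obtain ⟨P, hP⟩ := hsurj v
  have hcomp : sortedWordMap X V.toSubmodule ∘ₗ
      Finsupp.mapRange.linearMap (Submodule.inclusion hWV) = sortedWordMap X W := by
    ext s w
    simp
  rw [← hcomp, LinearMap.comp_apply] at hP
  have hv : Finsupp.mapRange.linearMap (Submodule.inclusion hWV) P =
      Finsupp.single (0 : Multiset ι) (v : V.toSubmodule) := by
    apply hinj
    rw [hP, sortedWordMap_single, Multiset.sort_zero, lieWord_nil]
  have hv0 : Submodule.inclusion hWV (P 0) = v := by
    simpa using DFunLike.congr_fun hv 0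
  obtain ⟨v', hv', h'⟩ := (P 0).2
  have : v' = v := Subtype.ext (h'.trans (congrArg Subtype.val hv0))
  exact this ▸ hv'

end InducedLift

/-! ## Filtrations of the extended Heisenberg-Virasoro algebra -/

namespace ExtHV

section Filtrations

variable (α β F : ℂ)

/-- The degree of a basis element, for which `𝓛_d` is the part of nonnegative degree. -/
def degree (d : ℕ) : EHVIndex → ℤ
  | .L m => m
  | .J m => m
  | .G m => m + d
  | .C1 => 0
  | .C2 => 0
  | .C3 => 0

/-- The order of a basis element: the basis elements of positive order are those that kill
`N_{k,k+d,l}` by definition. -/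
def order (d k l : ℕ) : EHVIndex → ℤ
  | .L m => m - l
  | .J m => m - k - d
  | .G m => m - k
  | .C1 => -1
  | .C2 => -1
  | .C3 => -1

/-- The span of the basis elements on which `f` is at least `n`. -/
def filtration (f : EHVIndex → ℤ) (n : ℤ) : Submodule ℂ (ExtHV α β F) :=
  Submodule.span ℂ (basis α β F '' {x | n ≤ f x})

variable {α β F}

theorem basis_mem_filtration {f : EHVIndex → ℤ} {n : ℤ} {x : EHVIndex} (hx : n ≤ f x) :
    basis α β F x ∈ filtration α β F f n :=
  Submodule.subset_span ⟨x, hx, rfl⟩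

theorem filtration_antitone (f : EHVIndex → ℤ) : Antitone (filtration α β F f) :=
  fun _ _ h => Submodule.span_mono (Set.image_mono fun _ hx => h.trans hx)

theorem filtration_le {f : EHVIndex → ℤ} {n : ℤ} {W : Submodule ℂ (ExtHV α β F)}
    (h : ∀ x, n ≤ f x → basis α β F x ∈ W) : filtration α β F f n ≤ W := by
  refine Submodule.span_le.mpr ?_
  rintro _ ⟨x, hx, rfl⟩
  exact h x hx

theorem lie_mem_filtration {f g h : EHVIndex → ℤ}
    (H : ∀ x y, basisBracket α β F x y ∈ filtration α β F h (f x + g y)) {m n : ℤ}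
    {x y : ExtHV α β F} (hx : x ∈ filtration α β F f m) (hy : y ∈ filtration α β F g n) :
    ⁅x, y⁆ ∈ filtration α β F h (m + n) := by
  induction hx, hy using Submodule.span_induction₂ with
  | mem_mem x y hx hy =>
    obtain ⟨i, hi, rfl⟩ := hx
    obtain ⟨j, hj, rfl⟩ := hy
    rw [lie_basis]
    exact filtration_antitone h (add_le_add hi hj) (H i j)
  | zero_left y hy => simp
  | zero_right x hx => simp
  | add_left x y z _ _ _ h1 h2 => rw [add_lie]; exact add_mem h1 h2
  | add_right x y z _ _ _ h1 h2 => rw [lie_add]; exact add_mem h1 h2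
  | smul_left r x y _ _ h => rw [smul_lie]; exact Submodule.smul_mem _ r h
  | smul_right r x y _ _ h => rw [lie_smul]; exact Submodule.smul_mem _ r h

theorem ite_smul_mem {W : Submodule ℂ (ExtHV α β F)} {p : Prop} [Decidable p] {c : ℂ}
    {z : ExtHV α β F} (h : p → z ∈ W) : (if p then c • z else 0) ∈ W := by
  split_ifs with hp
  · exact W.smul_mem c (h hp)
  · exact W.zero_mem

theorem basisBracket_mem_filtration {f g h : EHVIndex → ℤ}
    (hLL : ∀ m n, f (.L m) + g (.L n) ≤ h (.L (m + n)))
    (hLL' : ∀ m n, m + n = 0 → f (.L m) + g (.L n) ≤ h .C1)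
    (hLJ : ∀ m n, f (.L m) + g (.J n) ≤ h (.J (m + n)))
    (hLJ' : ∀ m n, m + n = 0 → f (.L m) + g (.J n) ≤ h .C2)
    (hJL : ∀ m n, f (.J m) + g (.L n) ≤ h (.J (n + m)))
    (hJL' : ∀ m n, n + m = 0 → f (.J m) + g (.L n) ≤ h .C2)
    (hJJ : ∀ m n, m + n = 0 → f (.J m) + g (.J n) ≤ h .C3)
    (hLG : ∀ m n, f (.L m) + g (.G n) ≤ h (.G (m + n)))
    (hGL : ∀ m n, f (.G m) + g (.L n) ≤ h (.G (n + m)))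
    (hJG : ∀ m n, f (.J m) + g (.G n) ≤ h (.G (m + n)))
    (hGJ : ∀ m n, f (.G m) + g (.J n) ≤ h (.G (n + m))) (x y : EHVIndex) :
    basisBracket α β F x y ∈ filtration α β F h (f x + g y) := by
  have hb := @basis_mem_filtration α β F h
  rcases x with m | m | m | _ | _ | _ <;> rcases y with n | n | n | _ | _ | _ <;>
    simp only [basisBracket, zero_mem, neg_mem_iff]
  · exact add_mem (Submodule.smul_mem _ _ (hb (hLL m n))) (ite_smul_mem fun e => hb (hLL' m n e))
  · exact sub_mem (Submodule.smul_mem _ _ (hb (hLJ m n))) (ite_smul_mem fun e => hb (hLJ' m n e))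
  · exact Submodule.smul_mem _ _ (hb (hLG m n))
  · exact sub_mem (Submodule.smul_mem _ _ (hb (hJL m n))) (ite_smul_mem fun e => hb (hJL' m n e))
  · exact ite_smul_mem fun e => hb (hJJ m n e)
  · exact Submodule.smul_mem _ _ (hb (hJG m n))
  · exact Submodule.smul_mem _ _ (hb (hGL m n))
  · exact Submodule.smul_mem _ _ (hb (hGJ m n))

theorem lie_mem_filtration_degree {d : ℕ} {m n : ℤ} {x y : ExtHV α β F}
    (hx : x ∈ filtration α β F (degree d) m) (hy : y ∈ filtration α β F (degree d) n) :
    ⁅x, y⁆ ∈ filtration α β F (degree d) (m + n) := by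
  refine lie_mem_filtration (basisBracket_mem_filtration ?_ ?_ ?_ ?_ ?_ ?_ ?_ ?_ ?_ ?_ ?_) hx hy <;>
    (simp only [degree]; omega)

/-- Bracketing `L_m` with `J_n` or `G_n` trades the threshold `l` for `k + d`, which respects
`order` because `l ≥ k + d`. Central terms arise only from total at most `-(k + d) < 0`, so order
`-1` is admissible for them. -/
theorem lie_mem_filtration_order {d k l : ℕ} (hkd : 0 < k + d) (hl : k + d < l) {m n : ℤ}
    {x y : ExtHV α β F} (hx : x ∈ filtration α β F (order d k l) m)
    (hy : y ∈ filtration α β F (degree d) n) :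
    ⁅x, y⁆ ∈ filtration α β F (order d k l) (m + n) := by
  refine lie_mem_filtration (basisBracket_mem_filtration ?_ ?_ ?_ ?_ ?_ ?_ ?_ ?_ ?_ ?_ ?_) hx hy <;>
    (simp only [degree, order]; omega)

theorem filtration_order_le {d k l : ℕ} (hkd : 0 < k + d) (hl : k + d < l) (n : ℤ) :
    filtration α β F (order d k l) n ≤ filtration α β F (degree d) (n + 1) := by
  refine filtration_le fun x hx => basis_mem_filtration ?_
  rcases x with m | m | m | _ | _ | _ <;> simp only [degree, order] at hx ⊢ <;> omega

theorem sub_toSubmodule (d : ℕ) :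
    (sub α β F d).toSubmodule = filtration α β F (degree d) 0 := by
  change Submodule.span ℂ _ = Submodule.span ℂ _
  congr 2
  ext x
  rcases x with m | m | m | _ | _ | _ <;>
    (simp only [subIndex, IsSubIndex, degree, Set.mem_ofPred_eq, le_refl]; try omega)

/-- The labels of the basis elements outside of `𝓛_d`. -/
abbrev NegIndex (d : ℕ) : Type := {x : EHVIndex // degree d x < 0}

/-- The degree of a basis element outside of `𝓛_d`, with the opposite sign. -/
def negWeight (d : ℕ) (a : NegIndex d) : ℕ := (-degree d a.1).toNat

theorem negWeight_coe (d : ℕ) (a : NegIndex d) : (negWeight d a : ℤ) = -degree d a.1 := by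
  have := a.2
  rw [negWeight]
  omega

variable (α β F) in
/-- The basis elements outside of `𝓛_d`. -/
def negBasis (d : ℕ) (a : NegIndex d) : ExtHV α β F := basis α β F a.1

theorem sub_sup_span_negBasis (d : ℕ) :
    (sub α β F d).toSubmodule ⊔ Submodule.span ℂ (Set.range (negBasis α β F d)) = ⊤ := by
  rw [eq_top_iff, ← (basis α β F).span_eq, Submodule.span_le, sub_toSubmodule]
  rintro _ ⟨x, rfl⟩
  by_cases hx : 0 ≤ degree d x
  · exact Submodule.mem_sup_left (basis_mem_filtration hx)
  · exact Submodule.mem_sup_right (Submodule.subset_span ⟨⟨x, not_le.mp hx⟩, rfl⟩)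

end Filtrations

/-! ### The subspaces `N_{r,s,t}` -/

section Annihilated

variable {α β F : ℂ} {S : Type*} [AddCommGroup S] [Module ℂ S] [LieRingModule (ExtHV α β F) S]
  [LieModule ℂ (ExtHV α β F) S]

theorem mem_annihilated_iff {r s t : ℤ} {v : S} : v ∈ annihilated α β F S r s t ↔
    (∀ m, r < m → ⁅G α β F m, v⁆ = 0) ∧ (∀ m, s < m → ⁅J α β F m, v⁆ = 0) ∧
      ∀ m, t < m → ⁅L α β F m, v⁆ = 0 := by
  constructor
  · intro hv
    refine ⟨fun m hm => ?_, fun m hm => ?_, fun m hm => ?_⟩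
    · have := (hv (m - r).toNat (by omega)).1
      rwa [show r + ((m - r).toNat : ℤ) = m by omega] at this
    · have := (hv (m - s).toNat (by omega)).2.1
      rwa [show s + ((m - s).toNat : ℤ) = m by omega] at this
    · have := (hv (m - t).toNat (by omega)).2.2
      rwa [show t + ((m - t).toNat : ℤ) = m by omega] at this
  · rintro ⟨hG, hJ, hL⟩ i hi
    exact ⟨hG _ (by omega), hJ _ (by omega), hL _ (by omega)⟩

theorem annihilated_mono {r s t r' s' t' : ℤ} (hr : r ≤ r') (hs : s ≤ s') (ht : t ≤ t') :
    annihilated α β F S r s t ≤ annihilated α β F S r' s' t' := by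
  intro v hv
  rw [mem_annihilated_iff] at hv ⊢
  exact ⟨fun m hm => hv.1 m (by omega), fun m hm => hv.2.1 m (by omega),
    fun m hm => hv.2.2 m (by omega)⟩

theorem mem_annihilated_iff_filtration {d k l : ℕ} {v : S} :
    v ∈ annihilated α β F S k (k + d) l ↔
      ∀ y ∈ filtration α β F (order d k l) 1, ⁅y, v⁆ = 0 := by
  rw [mem_annihilated_iff]
  constructor
  · rintro ⟨hG, hJ, hL⟩ y hy
    induction hy using Submodule.span_induction with
    | mem y hy =>
      obtain ⟨x, hx, rfl⟩ := hy
      rw [Set.mem_ofPred_eq] at hx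
      rcases x with m | m | m | _ | _ | _ <;> simp only [order] at hx
      · exact hL m (by omega)
      · exact hJ m (by omega)
      · exact hG m (by omega)
      all_goals omega
    | zero => simp
    | add y z _ _ h1 h2 => rw [add_lie, h1, h2, add_zero]
    | smul c y _ h => rw [smul_lie, h, smul_zero]
  · intro h
    refine ⟨fun m hm => h _ (basis_mem_filtration ?_), fun m hm => h _ (basis_mem_filtration ?_),
      fun m hm => h _ (basis_mem_filtration ?_)⟩ <;> simp only [order] <;> omega

/-- For `z` of positive order and `y` of nonnegative degree, `[z, y]` has positive order again, so
it kills `v` as `z` does. -/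
theorem lie_mem_annihilated {d k l : ℕ} (hkd : 0 < k + d) (hl : k + d < l) {y : ExtHV α β F}
    (hy : y ∈ filtration α β F (degree d) 0) {v : S}
    (hv : v ∈ annihilated α β F S k (k + d) l) :
    ⁅y, v⁆ ∈ annihilated α β F S k (k + d) l := by
  rw [mem_annihilated_iff_filtration] at hv ⊢
  intro z hz
  rw [leibniz_lie, hv z hz, lie_zero, add_zero]
  exact hv _ (by simpa using lie_mem_filtration_order hkd hl hz hy)

theorem isWeighted_annihilated {d k l : ℕ} (hkd : 0 < k + d) (hl : k + d < l) :
    IsWeighted (negBasis α β F d) (negWeight d) (annihilated α β F S k (k + d) l)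
      (filtration α β F (degree d)) (filtration α β F (order d k l)) where
  wt_pos a := by
    have := negWeight_coe d a
    have := a.2
    omega
  antitone := filtration_antitone _
  le_sup n hn := filtration_le fun x hx => by
    by_cases h0 : 0 ≤ degree d x
    · exact Submodule.mem_sup_left (basis_mem_filtration h0)
    · refine Submodule.mem_sup_right (Submodule.subset_span ⟨⟨x, not_le.mp h0⟩, ?_, rfl⟩)
      rw [negWeight_coe]
      simpa using hx
  lie_mem_E n a y hy := by
    rw [negWeight_coe, sub_neg_eq_add]
    exact lie_mem_filtration_degree hy (basis_mem_filtration le_rfl)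
  lie_mem y hy v hv := lie_mem_annihilated hkd hl hy hv
  D_le := filtration_order_le hkd hl
  lie_mem_D n a y hy := by
    rw [negWeight_coe, sub_neg_eq_add]
    exact lie_mem_filtration_order hkd hl hy (basis_mem_filtration le_rfl)
  lie_eq_zero n hn y hy v hv :=
    mem_annihilated_iff_filtration.mp hv y (filtration_antitone _ hn hy)

/-- The position of a basis element among those of its degree in the proof of independence. -/
def indexRank : EHVIndex → ℕ
  | .L _ => 0
  | .J _ => 1
  | _ => 2

/-- The duals of `L_m`, `J_m`, `G_m` are `L_{l-m}`, `G_{k-m}`, `J_{k-m}`, with brackets that are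
nonzero multiples of `L_l`, `G_k`, `G_k`. The rank puts `L` first because the duals of `J` and `G`
may interact with the `L` of the same degree. -/
theorem exists_dual {d k l : ℕ} (hF : F ≠ 0) (hkd : 0 < k + d) (hl : k + d < l)
    (hG : ∀ v ∈ annihilated α β F S k (k + d) l, ⁅G α β F k, v⁆ = 0 → v = 0)
    (hL : ∀ v ∈ annihilated α β F S k (k + d) l, ⁅L α β F l, v⁆ = 0 → v = 0) (a : NegIndex d) :
    ∃ x ∈ filtration α β F (order d k l) (negWeight d a),
      (∀ v ∈ annihilated α β F S k (k + d) l, ⁅⁅x, negBasis α β F d a⁆, v⁆ = 0 → v = 0) ∧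
      ∀ b ≠ a, negWeight d b = negWeight d a → indexRank a.1 ≤ indexRank b.1 →
        ∀ v ∈ annihilated α β F S k (k + d) l, ⁅⁅x, negBasis α β F d b⁆, v⁆ = 0 := by
  have hwt : ∀ b, negWeight d b = negWeight d a → degree d b.1 = degree d a.1 := fun b hb => by
    have h1 := negWeight_coe d a
    have h2 := negWeight_coe d b
    omega
  rw [negWeight_coe]
  obtain ⟨a, ha⟩ := a
  simp only [negBasis] at *
  rcases a with m | m | m | _ | _ | _ <;> have ha' := ha <;> simp only [degree] at ha'
  · refine ⟨basis α β F (.L (l - m)), basis_mem_filtration (by simp only [order, degree]; omega), ?_, ?_⟩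
    · intro v hv h
      rw [lie_basis, basisBracket, if_neg (by omega), add_zero, sub_add_cancel, smul_lie] at h
      refine hL v hv ((smul_eq_zero.mp h).resolve_left ?_)
      -- The coefficient `l - 2m` is positive because `m < 0`.
      have : ((l - m - m : ℤ) : ℂ) ≠ 0 := Int.cast_ne_zero.mpr (by omega)
      simpa using this
    · rintro ⟨b, hb⟩ hba hbw - v hv
      have hbm := hwt _ hbw
      rcases b with n | n | n | _ | _ | _ <;> simp only [degree] at hbm
      · exact absurd (Subtype.ext (congrArg EHVIndex.L hbm)) hba
      -- The bracket is a multiple of `J_l`, and in the next case of `G_{l-d}`; both kill `V`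
      -- precisely because `l > k + d`.
      · rw [lie_basis, basisBracket, if_neg (by omega), sub_zero, smul_lie,
          (mem_annihilated_iff.mp hv).2.1 _ (by omega), smul_zero]
      · rw [lie_basis, basisBracket, smul_lie, (mem_annihilated_iff.mp hv).1 _ (by omega),
          smul_zero]
      all_goals omega
  · refine ⟨basis α β F (.G (k - m)), basis_mem_filtration (by simp only [order, degree]; omega), ?_, ?_⟩
    · intro v hv h
      rw [lie_basis, basisBracket, add_sub_cancel, neg_lie, smul_lie, neg_eq_zero] at h
      exact hG v hv ((smul_eq_zero.mp h).resolve_left hF)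
    · rintro ⟨b, hb⟩ hba hbw hrk v hv
      have hbm := hwt _ hbw
      rcases b with n | n | n | _ | _ | _ <;> simp only [degree, indexRank] at hbm hrk
      · omega
      · exact absurd (Subtype.ext (congrArg EHVIndex.J hbm)) hba
      · rw [lie_basis, basisBracket, zero_lie]
      all_goals omega
  · refine ⟨basis α β F (.J (k - m)), basis_mem_filtration (by simp only [order, degree]; omega), ?_, ?_⟩
    · intro v hv h
      rw [lie_basis, basisBracket, sub_add_cancel, smul_lie] at h
      exact hG v hv ((smul_eq_zero.mp h).resolve_left hF)
    · rintro ⟨b, hb⟩ hba hbw hrk v hv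
      have hbm := hwt _ hbw
      rcases b with n | n | n | _ | _ | _ <;> simp only [degree, indexRank] at hbm hrk
      · omega
      · omega
      · exact absurd (Subtype.ext (congrArg EHVIndex.G (add_right_cancel hbm))) hba
      all_goals omega
  all_goals omega

theorem injOn_annihilated_iff {r s t : ℤ} {x : ExtHV α β F} :
    Set.InjOn (fun v : S => ⁅x, v⁆) (annihilated α β F S r s t) ↔
      ∀ v ∈ annihilated α β F S r s t, ⁅x, v⁆ = 0 → v = 0 := by
  constructor
  · intro h v hv h0
    exact h hv (zero_mem _) (by simpa using h0)
  · intro h v hv w hw hvw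
    refine sub_eq_zero.mp (h _ (sub_mem hv hw) ?_)
    rw [lie_sub]
    exact sub_eq_zero.mpr hvw

/-- Minimality of `k` is taken over all `s` and `t`, and that of `l` over all `s`, so the
`J`-threshold can be enlarged freely afterwards. -/
theorem exists_annihilated_ne_bot [Nontrivial S] (hres : IsRestricted α β F S) {a b : ℕ}
    (ha : Function.Injective (fun v : S => ⁅G α β F a, v⁆))
    (hb : Function.Injective (fun v : S => ⁅L α β F b, v⁆)) :
    ∃ k d l : ℕ, 0 < k + d ∧ annihilated α β F S k (k + d) l ≠ ⊥ ∧
      Set.InjOn (fun v : S => ⁅G α β F k, v⁆) (annihilated α β F S k (k + d) l) ∧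
      Set.InjOn (fun v : S => ⁅L α β F l, v⁆) (annihilated α β F S k (k + d) l) := by
  classical
  have hk : ∃ k : ℕ, ∃ s t : ℤ, annihilated α β F S k s t ≠ ⊥ := by
    obtain ⟨v, hv⟩ := exists_ne (0 : S)
    obtain ⟨M, hM⟩ := hres v
    refine ⟨M.toNat, M, M, fun h => hv ((Submodule.mem_bot ℂ).mp (h ▸ ?_))⟩
    rw [mem_annihilated_iff]
    exact ⟨fun m hm => (hM m (by omega)).2.2, fun m hm => (hM m (by omega)).2.1,
      fun m hm => (hM m (by omega)).1⟩
  set k := Nat.find hk with hkdef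
  have hl : ∃ l : ℕ, ∃ s : ℤ, annihilated α β F S k s l ≠ ⊥ := by
    obtain ⟨s, t, hst⟩ := Nat.find_spec hk
    exact ⟨t.toNat, s, ne_bot_of_le_ne_bot hst (annihilated_mono le_rfl le_rfl (by omega))⟩
  obtain ⟨s, hs⟩ := Nat.find_spec hl
  set l := Nat.find hl with hldef
  -- This `d` makes `k + d` at least `s`, and the extra `1` ensures `k + d > 0`.
  refine ⟨k, s.toNat + 1, l, by omega,
    ne_bot_of_le_ne_bot hs (annihilated_mono le_rfl (by omega) le_rfl), ?_, ?_⟩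
  · rw [injOn_annihilated_iff]
    intro v hv h0
    rw [mem_annihilated_iff] at hv
    have hv' : ∀ m : ℤ, k ≤ m → ⁅G α β F m, v⁆ = 0 := fun m hm => by
      rcases hm.eq_or_lt with rfl | hm
      · exact h0
      · exact hv.1 m hm
    -- If `k ≤ a`, then `G_a` kills `v`, which covers `k = 0`; otherwise `k - 1` is a natural number
    -- and contradicts minimality.
    rcases le_or_gt k a with hka | hka
    · exact ha (by simpa using hv' a (by omega))
    · by_contra hv0
      refine Nat.find_min hk (m := k - 1) (by omega) ⟨(k : ℤ) + (s.toNat + 1 : ℕ), l, fun h => ?_⟩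
      refine hv0 ((Submodule.mem_bot ℂ).mp (h ▸ mem_annihilated_iff.mpr ?_))
      exact ⟨fun m hm => hv' m (by omega), hv.2.1, hv.2.2⟩
  · rw [injOn_annihilated_iff]
    intro v hv h0
    rw [mem_annihilated_iff] at hv
    have hv' : ∀ m : ℤ, l ≤ m → ⁅L α β F m, v⁆ = 0 := fun m hm => by
      rcases hm.eq_or_lt with rfl | hm
      · exact h0
      · exact hv.2.2 m hm
    rcases le_or_gt l b with hlb | hlb
    · exact hb (by simpa using hv' b (by omega))
    · by_contra hv0
      refine Nat.find_min hl (m := l - 1) (by omega) ⟨(k : ℤ) + (s.toNat + 1 : ℕ), fun h => ?_⟩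
      refine hv0 ((Submodule.mem_bot ℂ).mp (h ▸ mem_annihilated_iff.mpr ?_))
      exact ⟨hv.1, hv.2.1, fun m hm => hv' m (by omega)⟩

end Annihilated

end ExtHV

end

/-! ### The main theorem -/

theorem mainTheorem5 (α β F : ℂ) (hF : F ≠ 0)
    (S : Type*) [AddCommGroup S] [Module ℂ S] [LieRingModule (ExtHV α β F) S]
    [LieModule ℂ (ExtHV α β F) S]
    (hsimple : LieModule.IsIrreducible ℂ (ExtHV α β F) S)
    (hrestricted : ExtHV.IsRestricted α β F S)
    (hinj : ∃ a b : ℕ, Function.Injective (fun v : S => ⁅ExtHV.G α β F a, v⁆) ∧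
      Function.Injective (fun v : S => ⁅ExtHV.L α β F b, v⁆)) :
    (∃ k d l : ℕ, 0 < k + d ∧
      ExtHV.annihilated α β F S k (k + d) l ≠ ⊥ ∧
      Set.InjOn (fun v : S => ⁅ExtHV.G α β F k, v⁆) (ExtHV.annihilated α β F S k (k + d) l) ∧
      Set.InjOn (fun v : S => ⁅ExtHV.L α β F l, v⁆) (ExtHV.annihilated α β F S k (k + d) l)) ∧
    ∀ k d l : ℕ, 0 < k + d →
      ExtHV.annihilated α β F S k (k + d) l ≠ ⊥ →
      Set.InjOn (fun v : S => ⁅ExtHV.G α β F k, v⁆) (ExtHV.annihilated α β F S k (k + d) l) →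
      Set.InjOn (fun v : S => ⁅ExtHV.L α β F l, v⁆) (ExtHV.annihilated α β F S k (k + d) l) →
      k + d < l →
      ∃ V : LieSubmodule ℂ (ExtHV.sub α β F d) S,
        V.toSubmodule = ExtHV.annihilated α β F S k (k + d) l ∧
        LieModule.IsIrreducible ℂ (ExtHV.sub α β F d) V ∧
        ExtHV.InductionConditions α β F d k l V ∧
        Nonempty (S ≃ₗ⁅ℂ, ExtHV α β F⁆ InducedModule ℂ (ExtHV.sub α β F d) V) := by
  constructor
  · obtain ⟨a, b, ha, hb⟩ := hinj
    have : Nontrivial S := (LieSubmodule.nontrivial_iff ℂ (ExtHV α β F) S).mp hsimple.toNontrivial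
    exact ExtHV.exists_annihilated_ne_bot hrestricted ha hb
  · intro k d l hkd hne hG hL hl
    let V : LieSubmodule ℂ (ExtHV.sub α β F d) S :=
      { ExtHV.annihilated α β F S k (k + d) l with
        lie_mem := fun {y v} hv =>
          ExtHV.lie_mem_annihilated hkd hl (ExtHV.sub_toSubmodule (α := α) d ▸ y.2) hv }
    have hV : V.toSubmodule = ExtHV.annihilated α β F S k (k + d) l := rfl
    have hVne : V.toSubmodule ≠ ⊥ := hne
    classical
    -- Any linear order serves: it only fixes how words are sorted and need not be compatible with
    -- weight or rank.
    let _ : LinearOrder (ExtHV.NegIndex d) := linearOrderOfSTO WellOrderingRel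
    have : IsAddTorsionFree S := .of_isTorsionFree ℂ S
    have hind : Function.Injective (sortedWordMap (ExtHV.negBasis α β F d) V.toSubmodule) :=
      (ExtHV.isWeighted_annihilated hkd hl).sortedWordMap_injective
        (fun a => ExtHV.indexRank a.1) (ExtHV.exists_dual hF hkd hl
          (ExtHV.injOn_annihilated_iff.mp hG) (ExtHV.injOn_annihilated_iff.mp hL))
    have hspan := ExtHV.sub_sup_span_negBasis (α := α) (β := β) (F := F) d
    refine ⟨V, hV, isIrreducible_of_sortedWordMap_injective V hsimple hVne hspan hind, ?_, ?_⟩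
    · exact
        { lt := hl
          pos := hkd
          injective_G := fun v w h => Subtype.ext (hG v.2 w.2 (congrArg Subtype.val h))
          injective_L := fun v w h => Subtype.ext (hL v.2 w.2 (congrArg Subtype.val h))
          G_eq_zero := fun i hi v => Subtype.ext (by
            have := (v.2 i hi).1
            rwa [← Nat.cast_add] at this)
          J_eq_zero := fun i hi v => Subtype.ext (by
            have := (v.2 i hi).2.1
            rwa [← Nat.cast_add, ← Nat.cast_add] at this)
          L_eq_zero := fun i hi v => Subtype.ext (by
            have := (v.2 i hi).2.2
            rwa [← Nat.cast_add] at this) }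
    · let e := LinearEquiv.ofBijective
        (inducedLift V : InducedModule ℂ (ExtHV.sub α β F d) V →ₗ[ℂ] S)
        (inducedLift_bijective V hsimple hVne hspan hind)
      let e' : InducedModule ℂ (ExtHV.sub α β F d) V ≃ₗ⁅ℂ, ExtHV α β F⁆ S :=
        { inducedLift V with
          invFun := e.symm
          left_inv := e.left_inv
          right_inv := e.right_inv }
      exact ⟨e'.symm⟩
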